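/- For a finite group $G$, let $\operatorname{Irr}(G)$ denote the set of characters of the irreducible complex representations of $G$, let $b(G)$ denote the largest degree of an irreducible complex representation of $G$, and put $$\varepsilon(G) := \frac{\sum_{\chi \in \operatorname{Irr}(G),\ \chi(1) < b(G)} |\chi(1)|^2}{b(G)^2}.$$ There is a constant $\varepsilon > 0$ such that $\varepsilon(\mathsf{A}_n) \geq \varepsilon$ for all $n \geq 5$, where $\mathsf{A}_n$ is the alternating group of degree $n$. -/

import Mathlib

/-- `Irr(G)`: the set of characters of the irreducible finite-dimensional complex
representations of `G`. (Letting `V` range over `Type` is no restriction, as every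
finite-dimensional complex vector space is isomorphic to some `Fin d → ℂ`.) -/
def Irr (G : Type*) [Group G] : Set (G → ℂ) :=
  {χ | ∃ (V : Type) (_ : AddCommGroup V) (_ : Module ℂ V) (_ : FiniteDimensional ℂ V)
    (ρ : Representation ℂ G V), ρ.IsIrreducible ∧ ρ.character = χ}

/-- The set of degrees of the irreducible finite-dimensional complex representations of `G`. -/
def irrDegrees (G : Type*) [Group G] : Set ℕ :=
  {d | ∃ (V : Type) (_ : AddCommGroup V) (_ : Module ℂ V) (_ : FiniteDimensional ℂ V)
    (ρ : Representation ℂ G V), ρ.IsIrreducible ∧ Module.finrank ℂ V = d}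

/-- `b(G)`: the largest degree of an irreducible complex representation of `G`; for finite `G`
the supremum is a maximum, see `isGreatest_maxIrrDegree`. -/
noncomputable def maxIrrDegree (G : Type*) [Group G] : ℕ := sSup (irrDegrees G)

theorem Irr_finite (G : Type*) [Group G] [Finite G] : (Irr G).Finite := by
  classical
  have : Fintype G := Fintype.ofFinite G
  have hc : (Nat.card G : ℂ) ≠ 0 := Nat.cast_ne_zero.2 Nat.card_pos.ne'
  let _ : Invertible (Nat.card G : ℂ) := invertibleOfNonzero hc
  have key : ∀ χ ∈ Irr G, ∀ ψ ∈ Irr G,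
      (Nat.card G : ℂ)⁻¹ * ∑ g : G, χ g * ψ g⁻¹ = if χ = ψ then 1 else 0 := by
    rintro χ ⟨V, i1, i2, i3, ρ, hρ, rfl⟩ ψ ⟨W, j1, j2, j3, σ, hσ, rfl⟩
    by_cases h : Nonempty (Representation.Equiv σ ρ)
    · have e : ρ.character = σ.character := (Representation.char_iso h.some).symm
      rw [Representation.char_orthonormal, if_pos h, if_pos e]
    · rw [Representation.char_orthonormal, if_neg h, if_neg]
      intro e
      have h1 := Representation.char_orthonormal ρ σ
      have h2 := Representation.char_orthonormal ρ ρ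
      rw [if_neg h] at h1
      rw [if_pos ⟨Representation.Equiv.refl ρ⟩] at h2
      rw [← e] at h1
      exact one_ne_zero (h2.symm.trans h1)
  have li : LinearIndependent ℂ (fun χ : Irr G => (χ : G → ℂ)) := by
    rw [linearIndependent_iff']
    intro s c hs χ hχ
    have h0 : (Nat.card G : ℂ)⁻¹ *
        ∑ g : G, (∑ ψ ∈ s, c ψ • (ψ : G → ℂ)) g * (χ : G → ℂ) g⁻¹ = 0 := by
      rw [hs]; simp
    have h1 : (Nat.card G : ℂ)⁻¹ *
        ∑ g : G, (∑ ψ ∈ s, c ψ • (ψ : G → ℂ)) g * (χ : G → ℂ) g⁻¹ =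
        ∑ ψ ∈ s, c ψ * ((Nat.card G : ℂ)⁻¹ * ∑ g : G, (ψ : G → ℂ) g * (χ : G → ℂ) g⁻¹) := by
      simp only [Finset.sum_apply, Pi.smul_apply, smul_eq_mul, Finset.sum_mul, Finset.mul_sum]
      rw [Finset.sum_comm]
      refine Finset.sum_congr rfl fun _ _ => Finset.sum_congr rfl fun _ _ => by ring
    rw [h1, Finset.sum_congr rfl fun ψ _ => by rw [key ψ ψ.2 χ χ.2]] at h0
    simpa [Subtype.coe_inj, hχ] using h0
  have := li.finite
  exact Set.toFinite _

theorem isGreatest_maxIrrDegree (G : Type*) [Group G] [Finite G] :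
    IsGreatest (irrDegrees G) (maxIrrDegree G) := by
  have hfin : (irrDegrees G).Finite := by
    refine Set.Finite.subset ((Irr_finite G).image fun χ => ⌊‖χ 1‖⌋₊) ?_
    rintro d ⟨V, i1, i2, i3, ρ, hρ, rfl⟩
    exact ⟨ρ.character, ⟨V, i1, i2, i3, ρ, hρ, rfl⟩, by simp⟩
  have hne : (irrDegrees G).Nonempty := by
    refine ⟨1, ℂ, inferInstance, inferInstance, inferInstance, Representation.trivial ℂ G ℂ,
      ?_, Module.finrank_self ℂ⟩
    have hsub : ∀ W : Subrepresentation (Representation.trivial ℂ G ℂ), W = ⊥ ∨ W = ⊤ := by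
      intro W
      rcases eq_bot_or_eq_top W.toSubmodule with h | h
      · exact Or.inl (Subrepresentation.toSubmodule_injective h)
      · exact Or.inr (Subrepresentation.toSubmodule_injective h)
    have : Nontrivial (Subrepresentation (Representation.trivial ℂ G ℂ)) :=
      ⟨⊥, ⊤, fun h => bot_ne_top (α := Submodule ℂ ℂ)
        (congrArg Subrepresentation.toSubmodule h)⟩
    exact ⟨hsub⟩
  exact ⟨Nat.sSup_mem hne hfin.bddAbove, fun d hd => le_csSup hfin.bddAbove hd⟩

/-- `ε(G)`: the sum of `|χ(1)|²` over all `χ ∈ Irr(G)` with `χ(1) < b(G)`, divided by `b(G)²`.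
As `χ(1)` is a natural number, seen in `ℂ`, it is compared with `b(G)` through its norm. -/
noncomputable def epsilonRatio (G : Type*) [Group G] [Finite G] : ℝ :=
  (∑ χ ∈ (Irr_finite G).toFinset with ‖χ 1‖ < (maxIrrDegree G : ℝ), ‖χ 1‖ ^ 2) /
    (maxIrrDegree G : ℝ) ^ 2

/-! ### Partitions as Maya diagrams -/

open Finset

/-! Irreducible representations of the symmetric group correspond to partitions `M` of `n`, with
degree the number f(M) of standard tableaux. Restricted to the alternating group, each stays
irreducible or splits into two halves. The sum of all transpositions is odd and acts as the content
sum of `M`, so splitting forces content sum 0. Let b be the largest degree for the alternating group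
and `B` the set of partitions whose constituents have degree b: on `B`, f is b, or 2b with content
sum 0. An irreducible character occurs in at most two restrictions, so for large `n` it suffices to
bound the sum of f² outside `B` below by a multiple of b² (`le_sum_sq_numWords_sdiff`). For each
smaller `n` the ratio is positive, and a minimum is taken.

Suppose that sum is tiny. Let `M` in `B` have the largest content sum and r removable boxes, p of
negative and q of nonnegative content. For a removable content y, consider the partitions got by
adding a box of content a to M − y. Their f add up to n f(M − y) (`upSum_one`), and those in `B`
have a ≤ y, so their number is at most one more than the rank of y among the removable contents.
Summing over y gives n ≤ r²/2 + O(r) up to a small defect from outside `B`. Since p² + q² ≤ n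
(`sq_card_removable_le`), this is nearly sharp, not absurd, but r has order √n. The contradiction
comes from the first moment: the contents a, weighted by f, have mean zero (`upSum_id`), yet for y <
0 those leading into `B` are all negative. Only the defect can balance them, and Cauchy–Schwarz
makes it too small (`mul_upDegree_le`, `sq_sum_defect_le`, `extremal_contradiction`).

The representations are built in Young's orthogonal form. The Jucys–Murphy elements act diagonally
by contents, which gives irreducibility and inequivalence; the identity ∑ f² = n! gives
completeness.

A partition is encoded by the multiset of contents of its boxes, its boundary by a Maya diagram: the
empty partition has beads at all c ≤ 0, and adding a box of content a moves a bead from a to a + 1.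
-/

def bead (M : Multiset ℤ) (c : ℤ) : ℤ :=
  (if c ≤ 0 then 1 else 0) - M.count c + M.count (c - 1)

/-- Off this finite set the diagram agrees locally with that of the empty partition and has no
corner. The point 0 is included as the addable corner of the empty partition. -/
def boundary (M : Multiset ℤ) : Finset ℤ :=
  insert 0 (M.toFinset ∪ M.toFinset.image (· + 1) ∪ M.toFinset.image (· - 1))

def addable (M : Multiset ℤ) : Finset ℤ :=
  (boundary M).filter fun c => bead M c = 1 ∧ bead M (c + 1) = 0

def removable (M : Multiset ℤ) : Finset ℤ :=
  (boundary M).filter fun c => bead M c = 0 ∧ bead M (c + 1) = 1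

theorem bead_of_notMem_boundary {M : Multiset ℤ} {c : ℤ} (h : c ∉ boundary M) :
    c ≠ 0 ∧ bead M c = (if c ≤ 0 then 1 else 0) ∧
      bead M (c + 1) = (if c + 1 ≤ 0 then 1 else 0) := by
  simp only [boundary, mem_insert, mem_union, Multiset.mem_toFinset, mem_image, not_or,
    not_exists, not_and] at h
  obtain ⟨h0, ⟨h1, h2⟩, h3⟩ := h
  have e1 : M.count c = 0 := Multiset.count_eq_zero.2 h1
  have e2 : M.count (c - 1) = 0 := Multiset.count_eq_zero.2 fun h => h2 _ h (by ring)
  have e3 : M.count (c + 1) = 0 := Multiset.count_eq_zero.2 fun h => h3 _ h (by ring)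
  simp [bead, e1, e2, e3, h0]

theorem mem_addable {M : Multiset ℤ} {c : ℤ} :
    c ∈ addable M ↔ bead M c = 1 ∧ bead M (c + 1) = 0 := by
  refine ⟨fun h => (mem_filter.1 h).2, fun h => mem_filter.2 ⟨?_, h⟩⟩
  by_contra hc
  obtain ⟨h0, h1, h2⟩ := bead_of_notMem_boundary hc
  rw [h1, h2] at h
  split_ifs at h <;> omega

theorem mem_removable {M : Multiset ℤ} {c : ℤ} :
    c ∈ removable M ↔ bead M c = 0 ∧ bead M (c + 1) = 1 := by
  refine ⟨fun h => (mem_filter.1 h).2, fun h => mem_filter.2 ⟨?_, h⟩⟩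
  by_contra hc
  obtain ⟨h0, h1, h2⟩ := bead_of_notMem_boundary hc
  rw [h1, h2] at h
  split_ifs at h <;> omega

theorem bead_cons (a : ℤ) (M : Multiset ℤ) (c : ℤ) :
    bead (a ::ₘ M) c = bead M c - (if c = a then 1 else 0) + (if c = a + 1 then 1 else 0) := by
  have : c - 1 = a ↔ c = a + 1 := by omega
  simp only [bead, Multiset.count_cons, this]
  push_cast
  ring

theorem bead_erase {b : ℤ} {M : Multiset ℤ} (h : b ∈ M) (c : ℤ) :
    bead (M.erase b) c = bead M c + (if c = b then 1 else 0) - (if c = b + 1 then 1 else 0) := by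
  conv_rhs => rw [← Multiset.cons_erase h, bead_cons]
  ring

def shape {n : ℕ} (w : Fin n → ℤ) : Multiset ℤ := univ.val.map w

theorem shape_succ {n : ℕ} (w : Fin (n + 1) → ℤ) : shape w = w 0 ::ₘ shape (Fin.tail w) := by
  simp [shape, Fin.univ_val_map, List.ofFn_succ, Fin.tail_def]

theorem shape_cons {n : ℕ} (c : ℤ) (w : Fin n → ℤ) :
    shape (Fin.cons c w : Fin (n + 1) → ℤ) = c ::ₘ shape w := by
  simp [shape_succ]

theorem card_shape {n : ℕ} (w : Fin n → ℤ) : (shape w).card = n := by simp [shape]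

theorem sum_shape {n : ℕ} (w : Fin n → ℤ) : (shape w).sum = ∑ i, w i := rfl

theorem shape_comp_perm {n : ℕ} (w : Fin n → ℤ) (σ : Equiv.Perm (Fin n)) :
    shape (w ∘ σ) = shape w := by
  have h : (univ : Finset (Fin n)).val.map σ = univ.val := by
    simp
  rw [shape, ← Multiset.map_map, h, shape]

/-- A standard tableau is recorded by the contents of its boxes, the newest box first. -/
def words : (n : ℕ) → Finset (Fin n → ℤ)
  | 0 => univ
  | n + 1 => (words n).biUnion fun w => (addable (shape w)).image fun c => Fin.cons c w

theorem mem_words_succ {n : ℕ} {w : Fin (n + 1) → ℤ} :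
    w ∈ words (n + 1) ↔ Fin.tail w ∈ words n ∧ w 0 ∈ addable (shape (Fin.tail w)) := by
  simp only [words, mem_biUnion, mem_image]
  constructor
  · rintro ⟨v, hv, c, hc, rfl⟩
    simp [hv, hc]
  · rintro ⟨h1, h2⟩
    exact ⟨_, h1, _, h2, Fin.cons_self_tail w⟩

theorem cons_mem_words {n : ℕ} {w : Fin n → ℤ} {c : ℤ} :
    (Fin.cons c w : Fin (n + 1) → ℤ) ∈ words (n + 1) ↔ w ∈ words n ∧ c ∈ addable (shape w) := by
  simp [mem_words_succ]

def shapes (n : ℕ) : Finset (Multiset ℤ) := (words n).image shape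

theorem mem_shapes_zero {M : Multiset ℤ} : M ∈ shapes 0 ↔ M = 0 := by
  simp [shapes, words, shape]

theorem mem_shapes_succ {n : ℕ} {M : Multiset ℤ} :
    M ∈ shapes (n + 1) ↔ ∃ M' ∈ shapes n, ∃ a ∈ addable M', M = a ::ₘ M' := by
  simp only [shapes, mem_image]
  constructor
  · rintro ⟨w, hw, rfl⟩
    rw [mem_words_succ] at hw
    exact ⟨_, ⟨_, hw.1, rfl⟩, _, hw.2, shape_succ w⟩
  · rintro ⟨_, ⟨w, hw, rfl⟩, a, ha, rfl⟩
    exact ⟨Fin.cons a w, cons_mem_words.2 ⟨hw, ha⟩, shape_cons a w⟩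

theorem cons_mem_shapes {n : ℕ} {M : Multiset ℤ} (hM : M ∈ shapes n) {a : ℤ}
    (ha : a ∈ addable M) : a ::ₘ M ∈ shapes (n + 1) :=
  mem_shapes_succ.2 ⟨M, hM, a, ha, rfl⟩

theorem card_of_mem_shapes {n : ℕ} {M : Multiset ℤ} (hM : M ∈ shapes n) : M.card = n := by
  obtain ⟨w, -, rfl⟩ := mem_image.1 hM
  exact card_shape w

theorem bead_eq_zero_or_one {n : ℕ} {M : Multiset ℤ} (hM : M ∈ shapes n) (c : ℤ) :
    bead M c = 0 ∨ bead M c = 1 := by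
  induction n generalizing M with
  | zero =>
    rw [mem_shapes_zero] at hM
    subst hM
    by_cases h : c ≤ 0 <;> simp [bead, h]
  | succ n ih =>
    obtain ⟨M', hM', a, ha, rfl⟩ := mem_shapes_succ.1 hM
    rw [mem_addable] at ha
    rw [bead_cons]
    have := ih hM'
    by_cases h1 : c = a
    · subst h1; simp [ha.1]
    · by_cases h2 : c = a + 1
      · subst h2; simp [ha.2]
      · simpa [h1, h2] using this

theorem abs_le_of_mem_addable {n : ℕ} {M : Multiset ℤ} (h : ∀ m ∈ M, |m| < n) {a : ℤ}
    (ha : a ∈ addable M) : |a| ≤ n := by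
  rw [mem_addable] at ha
  have key : ∀ m : ℤ, (n : ℤ) ≤ |m| → M.count m = 0 := fun m hm =>
    Multiset.count_eq_zero.2 fun hm' => absurd (h m hm') (by omega)
  by_contra! hc
  rcases lt_abs.1 hc with h1 | h1
  · have e := ha.1
    rw [bead, key (a - 1) (by rw [le_abs]; omega), if_neg (by omega)] at e
    omega
  · have e := ha.2
    rw [bead, key (a + 1) (by rw [le_abs]; omega), if_pos (by omega)] at e
    omega

theorem abs_lt_of_mem_shapes {n : ℕ} {M : Multiset ℤ} (hM : M ∈ shapes n) :
    ∀ m ∈ M, |m| < n := by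
  induction n generalizing M with
  | zero => simp [mem_shapes_zero.1 hM]
  | succ n ih =>
    obtain ⟨M', hM', a, ha, rfl⟩ := mem_shapes_succ.1 hM
    intro m hm
    push_cast
    rcases Multiset.mem_cons.1 hm with rfl | hm
    · have := abs_le_of_mem_addable (ih hM') ha
      omega
    · have := ih hM' m hm
      omega

/-- After the move, site `a` is empty and site `a + 1` is full, so neither neighbour of `a` is a
removable content. -/
theorem mem_removable_of_cons {M : Multiset ℤ} {a b : ℤ} (ha : a ∈ addable M)
    (hb : b ∈ removable (a ::ₘ M)) (hne : b ≠ a) :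
    b ∈ removable M ∧ a ≠ b + 1 ∧ a ≠ b - 1 := by
  rw [mem_addable] at ha
  rw [mem_removable, bead_cons, bead_cons] at hb
  obtain ⟨h1, h2⟩ := ha
  obtain ⟨h3, h4⟩ := hb
  have n1 : a ≠ b + 1 := by
    rintro rfl
    simp at h4
    omega
  have n2 : a ≠ b - 1 := by
    rintro rfl
    simp at h3 h2
    omega
  rw [mem_removable]
  refine ⟨?_, n1, n2⟩
  rw [if_neg hne, if_neg (by omega)] at h3
  rw [if_neg (by omega), if_neg (by omega)] at h4
  omega

theorem mem_of_mem_removable {n : ℕ} {M : Multiset ℤ} (hM : M ∈ shapes n) {b : ℤ}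
    (hb : b ∈ removable M) : b ∈ M := by
  induction n generalizing M with
  | zero =>
    rw [mem_shapes_zero.1 hM, mem_removable] at hb
    simp only [bead, Multiset.count_zero] at hb
    split_ifs at hb <;> omega
  | succ n ih =>
    obtain ⟨M', hM', a, ha, rfl⟩ := mem_shapes_succ.1 hM
    by_cases h : b = a
    · simp [h]
    · exact Multiset.mem_cons_of_mem (ih hM' (mem_removable_of_cons ha hb h).1)

/-- The compatibility of adding a box of content `a` with removing one of content `b`. -/
def NonAdj (a b : ℤ) : Prop := a ≠ b + 1 ∧ a ≠ b - 1

instance : DecidableRel NonAdj := fun _ _ => inferInstanceAs (Decidable (_ ∧ _))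

theorem removable_cons {M : Multiset ℤ} {a : ℤ} (ha : a ∈ addable M) :
    removable (a ::ₘ M) = insert a ((removable M).filter (NonAdj a)) := by
  ext b
  rw [mem_insert, mem_filter]
  constructor
  · intro hb
    by_cases h : b = a
    · exact Or.inl h
    · exact Or.inr (mem_removable_of_cons ha hb h)
  · rw [mem_addable] at ha
    rintro (rfl | ⟨hb, hb1, hb2⟩)
    · rw [mem_removable, bead_cons, bead_cons]
      simp [ha]
    · rw [mem_removable] at hb ⊢
      have : a ≠ b := by rintro rfl; omega
      rw [bead_cons, bead_cons, if_neg (by omega), if_neg (by omega), if_neg (by omega),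
        if_neg (by omega)]
      simpa using hb

theorem addable_erase {M : Multiset ℤ} {b : ℤ} (hb : b ∈ removable M) (hm : b ∈ M) :
    addable (M.erase b) = insert b ((addable M).filter (NonAdj · b)) := by
  rw [mem_removable] at hb
  ext a
  rw [mem_insert, mem_filter, mem_addable, mem_addable, bead_erase hm, bead_erase hm]
  simp only [NonAdj]
  by_cases h : a = b
  · subst h; simp [hb]
  · by_cases h1 : a = b + 1
    · subst h1; simp [hb]
    · by_cases h2 : a = b - 1
      · subst h2; simp [hb]
      · rw [if_neg h, if_neg h1, if_neg (by omega), if_neg (by omega)]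
        simp [h, h1, h2]

theorem not_mem_addable_of_mem_removable {M : Multiset ℤ} {b : ℤ} (hb : b ∈ removable M) :
    b ∉ addable M := by
  rw [mem_removable] at hb
  rw [mem_addable]
  omega

/-- If `b` is not the newest box, the two contents are nonadjacent, and the removal commutes with
the last addition. -/
theorem erase_mem_shapes {n : ℕ} {M : Multiset ℤ} (hM : M ∈ shapes (n + 1)) {b : ℤ}
    (hb : b ∈ removable M) : M.erase b ∈ shapes n := by
  induction n generalizing M with
  | zero =>
    obtain ⟨M', hM', a, ha, rfl⟩ := mem_shapes_succ.1 hM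
    have := mem_of_mem_removable hM hb
    rw [mem_shapes_zero] at hM'
    subst hM'
    simp at this
    subst this
    simp [mem_shapes_zero]
  | succ n ih =>
    obtain ⟨M', hM', a, ha, rfl⟩ := mem_shapes_succ.1 hM
    by_cases h : b = a
    · simpa [h] using hM'
    · obtain ⟨h1, h2⟩ := mem_removable_of_cons ha hb h
      rw [Multiset.erase_cons_tail _ (Ne.symm h)]
      refine cons_mem_shapes (ih hM' h1) ?_
      rw [addable_erase h1 (mem_of_mem_removable hM' h1)]
      exact mem_insert_of_mem (mem_filter.2 ⟨ha, h2⟩)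

/-- The number of standard Young tableaux of shape `M`. -/
def numWords (n : ℕ) (M : Multiset ℤ) : ℕ := ((words n).filter (shape · = M)).card

theorem numWords_succ {n : ℕ} {M : Multiset ℤ} (hM : M ∈ shapes (n + 1)) :
    numWords (n + 1) M = ∑ b ∈ removable M, numWords n (M.erase b) := by
  rw [numWords, Finset.card_eq_sum_card_fiberwise (f := fun w => w 0) (t := removable M)]
  · refine sum_congr rfl fun b hb => ?_
    have hbM := mem_of_mem_removable hM hb
    rw [numWords]
    symm
    refine card_bij (fun w _ => Fin.cons b w) ?_ ?_ ?_
    · intro w hw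
      obtain ⟨h1, h2⟩ := mem_filter.1 hw
      rw [mem_filter, mem_filter, cons_mem_words, shape_cons, h2, Multiset.cons_erase hbM]
      refine ⟨⟨⟨h1, ?_⟩, rfl⟩, rfl⟩
      rw [addable_erase hb hbM]
      exact mem_insert_self _ _
    · intro w _ w' _ h
      exact Fin.cons_right_injective (α := fun _ => ℤ) b h
    · intro w hw
      obtain ⟨hw1, hw2⟩ := mem_filter.1 hw
      obtain ⟨hw3, hw4⟩ := mem_filter.1 hw1
      refine ⟨Fin.tail w, mem_filter.2 ⟨(mem_words_succ.1 hw3).1, ?_⟩, ?_⟩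
      · rw [shape_succ] at hw4
        rw [← hw4, hw2, Multiset.erase_cons_head]
      · rw [← hw2]
        exact Fin.cons_self_tail w
  · intro w hw
    obtain ⟨h1, h2⟩ := mem_filter.1 hw
    rw [mem_words_succ] at h1
    rw [shape_succ] at h2
    rw [← h2, removable_cons h1.2]
    simp

/-! ### Moments of the up operator in Young's graph -/

def upSum (φ : ℤ → ℤ) (n : ℕ) (M : Multiset ℤ) : ℤ :=
  ∑ a ∈ addable M, φ a * numWords (n + 1) (a ::ₘ M)

/-- Adding `a` and removing `b ≠ a` can be done in either order, so these contributions cancel. Only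
the paths returning to `M` remain; they give the first term. -/
theorem upSum_succ (φ : ℤ → ℤ) {n : ℕ} {M : Multiset ℤ} (hM : M ∈ shapes (n + 1)) :
    upSum φ (n + 1) M = (∑ a ∈ addable M, φ a - ∑ b ∈ removable M, φ b) * numWords (n + 1) M +
      ∑ b ∈ removable M, upSum φ n (M.erase b) := by
  have h1 : upSum φ (n + 1) M = ∑ a ∈ addable M, φ a * numWords (n + 1) M +
      ∑ a ∈ addable M, ∑ b ∈ removable M,
        if NonAdj a b then φ a * numWords (n + 1) (a ::ₘ M.erase b) else 0 := by
    rw [upSum, ← sum_add_distrib]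
    refine sum_congr rfl fun a ha => ?_
    rw [numWords_succ (cons_mem_shapes hM ha), removable_cons ha, sum_insert, ← sum_filter,
      Multiset.erase_cons_head, Nat.cast_add, mul_add, Nat.cast_sum, mul_sum]
    · congr 1
      refine sum_congr rfl fun b hb => ?_
      rw [Multiset.erase_cons_tail]
      rintro rfl
      exact not_mem_addable_of_mem_removable (mem_filter.1 hb).1 ha
    · intro h
      exact not_mem_addable_of_mem_removable (mem_filter.1 h).1 ha
  have h2 : ∑ b ∈ removable M, upSum φ n (M.erase b) =
      ∑ b ∈ removable M, φ b * numWords (n + 1) M + ∑ b ∈ removable M, ∑ a ∈ addable M,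
        if NonAdj a b then φ a * numWords (n + 1) (a ::ₘ M.erase b) else 0 := by
    rw [← sum_add_distrib]
    refine sum_congr rfl fun b hb => ?_
    have hbM := mem_of_mem_removable hM hb
    rw [upSum, addable_erase hb hbM, sum_insert, ← sum_filter, Multiset.cons_erase hbM]
    intro h
    exact not_mem_addable_of_mem_removable hb (mem_filter.1 h).1
  rw [h1, h2, sum_comm, ← sum_mul, ← sum_mul]
  ring

/-- The left side is the sum of `φ c * (bead M c - bead M (c + 1))`, and moving one bead changes
that by a second difference of `φ`. -/
theorem sum_addable_sub_sum_removable {n : ℕ} {M : Multiset ℤ} (hM : M ∈ shapes n) (φ : ℤ → ℤ) :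
    ∑ a ∈ addable M, φ a - ∑ b ∈ removable M, φ b =
      φ 0 + (M.map fun m => φ (m + 1) - 2 * φ m + φ (m - 1)).sum := by
  have hlt := abs_lt_of_mem_shapes hM
  set I := Icc (-(n : ℤ) - 1) (n + 1) with hI
  have hA : addable M ⊆ I := fun a ha => by
    have := abs_le.1 (abs_le_of_mem_addable hlt ha)
    rw [hI, mem_Icc]; omega
  have hR : removable M ⊆ I := fun b hb => by
    have := abs_lt.1 (hlt b (mem_of_mem_removable hM hb))
    rw [hI, mem_Icc]; omega
  have e1 : ∑ a ∈ addable M, φ a - ∑ b ∈ removable M, φ b =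
      ∑ c ∈ I, φ c * (bead M c - bead M (c + 1)) := by
    have hA' : addable M = I.filter (· ∈ addable M) := by
      ext a; rw [mem_filter]; exact ⟨fun h => ⟨hA h, h⟩, fun h => h.2⟩
    have hR' : removable M = I.filter (· ∈ removable M) := by
      ext a; rw [mem_filter]; exact ⟨fun h => ⟨hR h, h⟩, fun h => h.2⟩
    rw [hA', hR', sum_filter, sum_filter, ← sum_sub_distrib]
    refine sum_congr rfl fun c _ => ?_
    simp only [mem_addable, mem_removable]
    rcases bead_eq_zero_or_one hM c with h1 | h1 <;>
    rcases bead_eq_zero_or_one hM (c + 1) with h2 | h2 <;> simp [h1, h2]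
  rw [e1]
  clear e1 hA hR hM
  induction M using Multiset.induction_on with
  | empty =>
    rw [sum_eq_single 0]
    · simp [bead]
    · intro c _ hc
      by_cases h : c ≤ 0
      · simp [bead, h, show c + 1 ≤ 0 by omega]
      · simp [bead, h, show ¬ c + 1 ≤ 0 by omega]
    · intro h
      exact absurd (by rw [hI, mem_Icc]; omega) h
  | cons a M ih =>
    have ha := abs_lt.1 (hlt a (Multiset.mem_cons_self a M))
    have ih' := ih fun m hm => hlt m (Multiset.mem_cons_of_mem hm)
    have e : ∑ c ∈ I, φ c * (bead (a ::ₘ M) c - bead (a ::ₘ M) (c + 1)) =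
        ∑ c ∈ I, φ c * (bead M c - bead M (c + 1)) +
        (∑ c ∈ I, (if c = a + 1 then φ c else 0) - 2 * ∑ c ∈ I, (if c = a then φ c else 0) +
          ∑ c ∈ I, (if c = a - 1 then φ c else 0)) := by
      rw [mul_sum, ← sum_sub_distrib, ← sum_add_distrib, ← sum_add_distrib]
      refine sum_congr rfl fun c _ => ?_
      rw [bead_cons, bead_cons]
      have q1 : c + 1 = a ↔ c = a - 1 := by omega
      simp only [q1, add_left_inj]
      split_ifs <;> ring
    rw [e, ih', sum_ite_eq', sum_ite_eq', sum_ite_eq', if_pos, if_pos, if_pos, Multiset.map_cons,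
      Multiset.sum_cons]
    · ring
    all_goals rw [hI, mem_Icc]; omega

theorem card_addable {n : ℕ} {M : Multiset ℤ} (hM : M ∈ shapes n) :
    (addable M).card = (removable M).card + 1 := by
  have := sum_addable_sub_sum_removable hM fun _ => 1
  simp at this
  omega

theorem sum_addable {n : ℕ} {M : Multiset ℤ} (hM : M ∈ shapes n) :
    ∑ a ∈ addable M, a = ∑ b ∈ removable M, b := by
  have := sum_addable_sub_sum_removable hM id
  have h0 : (M.map fun m : ℤ => m + 1 - 2 * m + (m - 1)).sum = 0 := by
    rw [Multiset.map_congr rfl (g := fun _ => (0 : ℤ)) fun m _ => by ring]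
    simp
  simp only [id, h0] at this
  omega

theorem card_addable_le {n : ℕ} {M : Multiset ℤ} (hM : M ∈ shapes n) (t : ℤ) :
    (((addable M).filter (· ≤ t)).card : ℤ) =
      ((removable M).filter (· ≤ t)).card + 1 - bead M (t + 1) := by
  have := sum_addable_sub_sum_removable hM fun c => if c ≤ t then 1 else 0
  rw [← sum_filter, ← sum_filter] at this
  have h0 : (M.map fun m : ℤ => ((if m + 1 ≤ t then 1 else 0) - 2 * (if m ≤ t then 1 else 0) +
      (if m - 1 ≤ t then 1 else 0) : ℤ)).sum = M.count (t + 1) - M.count t := by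
    clear this hM
    induction M using Multiset.induction_on with
    | empty => simp
    | cons a M ih =>
      rw [Multiset.map_cons, Multiset.sum_cons, ih, Multiset.count_cons, Multiset.count_cons]
      push_cast
      split_ifs <;> omega
  rw [h0] at this
  simp only [sum_const, nsmul_eq_mul, mul_one] at this
  simp only [bead, add_sub_cancel_right]
  split_ifs at this ⊢ <;> omega

theorem upSum_one {n : ℕ} {M : Multiset ℤ} (hM : M ∈ shapes n) :
    upSum (fun _ => 1) n M = (n + 1) * numWords n M := by
  induction n generalizing M with
  | zero =>
    rw [mem_shapes_zero] at hM
    subst hM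
    decide
  | succ n ih =>
    rw [upSum_succ _ hM, sum_congr rfl fun b hb => ih (erase_mem_shapes hM hb), ← mul_sum,
      numWords_succ hM]
    have := card_addable hM
    simp [this]
    ring

theorem upSum_id {n : ℕ} {M : Multiset ℤ} (hM : M ∈ shapes n) : upSum id n M = 0 := by
  induction n generalizing M with
  | zero =>
    rw [mem_shapes_zero] at hM
    subst hM
    decide
  | succ n ih =>
    rw [upSum_succ _ hM, sum_congr rfl fun b hb => ih (erase_mem_shapes hM hb)]
    simp [sum_addable hM]

/-- Edges of Young's graph between two levels, weighted by the product of `numWords` at both ends,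
are summed from below by `upSum_one` and from above by `numWords_succ`. -/
theorem sum_numWords_sq (n : ℕ) : ∑ M ∈ shapes n, numWords n M ^ 2 = n.factorial := by
  induction n with
  | zero => decide
  | succ n ih =>
    rw [Nat.factorial_succ, ← ih, mul_sum]
    have e1 : ∑ M ∈ shapes (n + 1), numWords (n + 1) M ^ 2 =
        ∑ M ∈ shapes (n + 1), ∑ b ∈ removable M, numWords (n + 1) M * numWords n (M.erase b) := by
      refine sum_congr rfl fun M hM => ?_
      rw [sq, ← mul_sum, ← numWords_succ hM]
    have e2 : ∀ M ∈ shapes n, (n + 1) * numWords n M ^ 2 =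
        ∑ a ∈ addable M, numWords (n + 1) (a ::ₘ M) * numWords n M := by
      intro M hM
      have := upSum_one hM
      rw [upSum] at this
      simp only [one_mul] at this
      rw [← sum_mul, sq, ← mul_assoc]
      congr 1
      exact_mod_cast this.symm
    rw [e1, sum_congr rfl e2, sum_sigma', sum_sigma']
    refine sum_bij' (fun x _ => ⟨x.1.erase x.2, x.2⟩) (fun x _ => ⟨x.2 ::ₘ x.1, x.2⟩) ?_ ?_ ?_ ?_ ?_
    · rintro ⟨M, b⟩ h
      rw [mem_sigma] at h ⊢
      refine ⟨erase_mem_shapes h.1 h.2, ?_⟩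
      rw [addable_erase h.2 (mem_of_mem_removable h.1 h.2)]
      exact mem_insert_self _ _
    · rintro ⟨M, b⟩ h
      rw [mem_sigma] at h ⊢
      refine ⟨cons_mem_shapes h.1 h.2, ?_⟩
      rw [removable_cons h.2]
      exact mem_insert_self _ _
    · rintro ⟨M, b⟩ h
      rw [mem_sigma] at h
      simp [Multiset.cons_erase (mem_of_mem_removable h.1 h.2)]
    · rintro ⟨M, b⟩ h
      simp
    · rintro ⟨M, b⟩ h
      rw [mem_sigma] at h
      simp [Multiset.cons_erase (mem_of_mem_removable h.1 h.2)]

/-! ### Energy and the number of corners -/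

/-- Each box moves a bead one step to the right, raising this energy by one. -/
theorem sum_mul_bead_sub {n : ℕ} {M : Multiset ℤ} (hM : ∀ m ∈ M, |m| < n) :
    ∑ c ∈ Icc (-(n : ℤ)) n, c * (bead M c - if c ≤ 0 then 1 else 0) = M.card := by
  induction M using Multiset.induction_on with
  | empty => simp [bead]
  | cons a M ih =>
    have ha := abs_lt.1 (hM a (Multiset.mem_cons_self a M))
    have e : ∑ c ∈ Icc (-(n : ℤ)) n, c * (bead (a ::ₘ M) c - if c ≤ 0 then 1 else 0) =
        ∑ c ∈ Icc (-(n : ℤ)) n, c * (bead M c - if c ≤ 0 then 1 else 0) +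
        (∑ c ∈ Icc (-(n : ℤ)) n, (if c = a + 1 then c else 0) -
          ∑ c ∈ Icc (-(n : ℤ)) n, (if c = a then c else 0)) := by
      rw [← sum_sub_distrib, ← sum_add_distrib]
      refine sum_congr rfl fun c _ => ?_
      rw [bead_cons]
      split_ifs <;> ring
    rw [e, ih fun m hm => hM m (Multiset.mem_cons_of_mem hm), sum_ite_eq', sum_ite_eq', if_pos,
      if_pos, Multiset.card_cons]
    · push_cast; ring
    all_goals rw [mem_Icc]; omega

theorem sum_ge_sq_of_nonadjacent (S : Finset ℤ) (h1 : ∀ x ∈ S, 1 ≤ x)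
    (h2 : ∀ x ∈ S, x + 1 ∉ S) : ((S.card : ℤ)) ^ 2 ≤ ∑ x ∈ S, x := by
  induction h : S.card generalizing S with
  | zero => exact (sum_nonneg fun x hx => by linarith [h1 x hx]).trans' (by simp)
  | succ k ih =>
    have hne : S.Nonempty := card_pos.1 (by omega)
    have hmax := S.max'_mem hne
    set m := S.max' hne
    have hc : (S.erase m).card = k := by rw [card_erase_of_mem hmax]; omega
    have := ih (S.erase m) (fun x hx => h1 x (mem_of_mem_erase hx))
      (fun x hx hx' => h2 x (mem_of_mem_erase hx) (mem_of_mem_erase hx')) hc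
    rw [← add_sum_erase S _ hmax]
    have hm : 2 * (k : ℤ) + 1 ≤ m := by
      -- The map sends the pair 2i + 1, 2i + 2 to i, and a nonadjacent set meets each pair at most
      -- once.
      have hinj : S.card ≤ (Icc 0 ((m - 1) / 2)).card := by
        refine card_le_card_of_injOn (fun x => (x - 1) / 2) ?_ ?_
        · intro x hx
          have q1 := h1 x hx
          have q2 := S.le_max' x hx
          simp only [coe_Icc, Set.mem_Icc]
          omega
        · intro x hx y hy hxy
          have q1 : y ≠ x + 1 := fun h => h2 x hx (h ▸ hy)
          have q2 : x ≠ y + 1 := fun h => h2 y hy (h ▸ hx)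
          have q3 := h1 x hx
          have q4 := h1 y hy
          simp only at hxy
          omega
      rw [Int.card_Icc] at hinj
      omega
    push_cast
    nlinarith

/-- A removable `y < 0` exhibits a hole at `y`, of energy `-y`; a removable `y ≥ 0` exhibits a bead
at `y + 1`, of energy `y + 1`. All energies are nonnegative with total `n`, and on each side these
positions are nonadjacent. -/
theorem sq_card_removable_le {n : ℕ} {M : Multiset ℤ} (hM : M ∈ shapes n) :
    (((removable M).filter (· < 0)).card : ℤ) ^ 2 + (((removable M).filter (0 ≤ ·)).card : ℤ) ^ 2
      ≤ n := by
  have hlt := abs_lt_of_mem_shapes hM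
  have hR : ∀ y ∈ removable M, |y| < n := fun y hy => hlt y (mem_of_mem_removable hM hy)
  have hna : ∀ y ∈ removable M, y + 1 ∉ removable M := fun y hy hy' => by
    rw [mem_removable] at hy hy'
    omega
  set A := ((removable M).filter (· < 0)).image fun y => -y with hA
  set B := ((removable M).filter (0 ≤ ·)).image fun y => y + 1 with hB
  have cA : A.card = ((removable M).filter (· < 0)).card :=
    card_image_of_injective _ neg_injective
  have cB : B.card = ((removable M).filter (0 ≤ ·)).card :=
    card_image_of_injective _ (add_left_injective 1)
  have sA := sum_ge_sq_of_nonadjacent A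
    (fun x hx => by simp only [hA, mem_image, mem_filter] at hx; omega)
    (fun x hx hx' => by
      simp only [hA, mem_image, mem_filter] at hx hx'
      obtain ⟨y, ⟨hy, -⟩, rfl⟩ := hx
      obtain ⟨z, ⟨hz, -⟩, h⟩ := hx'
      exact hna z hz (by rwa [show z + 1 = y by omega]))
  have sB := sum_ge_sq_of_nonadjacent B
    (fun x hx => by simp only [hB, mem_image, mem_filter] at hx; omega)
    (fun x hx hx' => by
      simp only [hB, mem_image, mem_filter] at hx hx'
      obtain ⟨y, ⟨hy, -⟩, rfl⟩ := hx
      obtain ⟨z, ⟨hz, -⟩, h⟩ := hx'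
      exact hna y hy (by rwa [show y + 1 = z by omega]))
  rw [cA] at sA
  rw [cB] at sB
  refine (add_le_add sA sB).trans ?_
  have hn := sum_mul_bead_sub hlt
  rw [card_of_mem_shapes hM] at hn
  rw [← hn, hA, hB, sum_image neg_injective.injOn, sum_image (add_left_injective 1).injOn]
  set F : ℤ → ℤ := fun c => c * (bead M c - if c ≤ 0 then 1 else 0) with hF
  have e1 : ∑ x ∈ (removable M).filter (· < 0), -x = ∑ x ∈ (removable M).filter (· < 0), F x := by
    refine sum_congr rfl fun x hx => ?_
    rw [mem_filter, mem_removable] at hx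
    rw [hF]
    simp [hx.1.1, hx.2.le]
  have e2 : ∑ x ∈ (removable M).filter (0 ≤ ·), (x + 1) = ∑ x ∈ B, F x := by
    rw [hB, sum_image (add_left_injective 1).injOn]
    refine sum_congr rfl fun x hx => ?_
    rw [mem_filter, mem_removable] at hx
    rw [hF]
    simp [hx.1.2, show ¬ x + 1 ≤ 0 by omega]
  rw [e1, e2, ← sum_union]
  · refine sum_le_sum_of_subset_of_nonneg ?_ ?_
    · intro x hx
      simp only [hB, mem_union, mem_filter, mem_image] at hx
      rw [mem_Icc]
      rcases hx with ⟨hx, -⟩ | ⟨y, ⟨hy, -⟩, rfl⟩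
      · have := abs_lt.1 (hR x hx); omega
      · have := abs_lt.1 (hR y hy); omega
    · intro c _ _
      rw [hF]
      by_cases h : c ≤ 0 <;> rcases bead_eq_zero_or_one hM c with h1 | h1 <;> simp [h, h1]
      all_goals omega
  · rw [disjoint_left]
    intro x hx hx'
    simp only [hB, mem_filter, mem_image] at hx hx'
    omega

theorem two_mul_sum_card_filter_le (S : Finset ℤ) :
    2 * ∑ y ∈ S, (S.filter (· ≤ y)).card = S.card * (S.card + 1) := by
  have h : ∑ y ∈ S, (S.filter (· ≤ y)).card = ∑ y ∈ S, (S.filter (y ≤ ·)).card := by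
    simp only [card_filter]
    rw [sum_comm]
  rw [two_mul]
  nth_rewrite 2 [h]
  rw [← sum_add_distrib, sum_congr rfl (g := fun _ => S.card + 1), sum_const, smul_eq_mul]
  intro y hy
  rw [← card_union_add_card_inter, ← filter_or, ← filter_and]
  congr 1
  · rw [filter_true_of_mem fun x _ => le_total x y]
  · rw [card_eq_one]
    refine ⟨y, ?_⟩
    ext x
    simp only [mem_filter, mem_singleton]
    constructor
    · rintro ⟨-, h1, h2⟩; omega
    · rintro rfl; exact ⟨hy, le_rfl, le_rfl⟩

/-! ### The extremal argument -/

section Extremal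

variable {n : ℕ} {M : Multiset ℤ} {B : Finset (Multiset ℤ)} {b : ℝ}

/-- The part of the up-degree of `M.erase y` which lies outside `B`. -/
noncomputable def defect (n : ℕ) (M : Multiset ℤ) (B : Finset (Multiset ℤ)) (y : ℤ) : ℝ :=
  ∑ a ∈ (addable (M.erase y)).filter (fun a => a ::ₘ M.erase y ∉ B),
    (numWords (n + 1) (a ::ₘ M.erase y) : ℝ)

theorem defect_nonneg (y : ℤ) : 0 ≤ defect n M B y := sum_nonneg fun _ _ => Nat.cast_nonneg _

/-- The content sum of `a ::ₘ ν` vanishes for only one `a`, so at most one term is `2 * b`. -/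
theorem sum_numWords_le (hB : ∀ μ ∈ B, (numWords (n + 1) μ : ℝ) = b ∨
      (numWords (n + 1) μ : ℝ) = 2 * b ∧ μ.sum = 0) (hb : 0 < b)
    (ν : Multiset ℤ) (T : Finset ℤ) (hT : ∀ a ∈ T, a ::ₘ ν ∈ B) :
    ∑ a ∈ T, (numWords (n + 1) (a ::ₘ ν) : ℝ) ≤ (T.card + 1) * b := by
  have h1 : ∀ a ∈ T, (numWords (n + 1) (a ::ₘ ν) : ℝ) ≤ b + if a = -ν.sum then b else 0 := by
    intro a ha
    rcases hB _ (hT a ha) with h | ⟨h, h'⟩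
    · rw [h]; split_ifs <;> linarith
    · rw [Multiset.sum_cons] at h'
      rw [h, if_pos (by omega)]; linarith
  refine (sum_le_sum h1).trans ?_
  rw [sum_add_distrib, sum_ite_eq', sum_const, nsmul_eq_mul]
  split_ifs <;> linarith

variable (hM : M ∈ shapes (n + 1)) (hMB : M ∈ B)
  (hmax : ∀ μ ∈ B, μ.sum ≤ M.sum)
  (hB : ∀ μ ∈ B, (numWords (n + 1) μ : ℝ) = b ∨
    (numWords (n + 1) μ : ℝ) = 2 * b ∧ μ.sum = 0) (hb : 0 < b)

include hM in
theorem upDegree_eq {y : ℤ} (hy : y ∈ removable M) :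
    ((n + 1 : ℕ) : ℝ) * numWords n (M.erase y) =
      ∑ a ∈ (addable (M.erase y)).filter (fun a => a ::ₘ M.erase y ∈ B),
        (numWords (n + 1) (a ::ₘ M.erase y) : ℝ) + defect n M B y := by
  have h := upSum_one (erase_mem_shapes hM hy)
  rw [upSum] at h
  simp only [one_mul] at h
  have h' : ((n + 1 : ℕ) : ℝ) * numWords n (M.erase y) =
      ∑ a ∈ addable (M.erase y), (numWords (n + 1) (a ::ₘ M.erase y) : ℝ) := by exact_mod_cast h.symm
  rw [h', defect, sum_filter_add_sum_filter_not]

include hM hmax in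
theorem le_of_mem_up {y a : ℤ} (hy : y ∈ removable M) (ha : a ::ₘ M.erase y ∈ B) : a ≤ y := by
  have h1 := hmax _ ha
  have h2 : y + (M.erase y).sum = M.sum := by
    rw [← Multiset.sum_cons, Multiset.cons_erase (mem_of_mem_removable hM hy)]
  rw [Multiset.sum_cons] at h1
  omega

include hM hmax hB hb in
-- A neighbour in `B` has `a ≤ y`, with `a` equal to `y` or addable to `M`. Corners interlace, so
-- `M` has as many addable as removable contents up to `y`. The 2 counts `y` itself and the possible
-- value `2 * b`.
theorem upDegree_le {y : ℤ} (hy : y ∈ removable M) :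
    ((n + 1 : ℕ) : ℝ) * numWords n (M.erase y) ≤
      (((removable M).filter (· ≤ y)).card + 2) * b + defect n M B y := by
  rw [upDegree_eq (B := B) hM hy]
  refine add_le_add_left ?_ _
  refine (sum_numWords_le hB hb _ _ fun a ha => (mem_filter.1 ha).2).trans ?_
  refine mul_le_mul_of_nonneg_right ?_ hb.le
  have h1 : (addable (M.erase y)).filter (fun a => a ::ₘ M.erase y ∈ B) ⊆
      insert y ((addable M).filter (· ≤ y)) := by
    intro a ha
    obtain ⟨h1, h2⟩ := mem_filter.1 ha
    have h3 := le_of_mem_up hM hmax hy h2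
    rw [addable_erase hy (mem_of_mem_removable hM hy), mem_insert, mem_filter] at h1
    rw [mem_insert, mem_filter]
    rcases h1 with h1 | h1
    · exact Or.inl h1
    · exact Or.inr ⟨h1.1, h3⟩
  have h2 := (card_le_card h1).trans (card_insert_le _ _)
  have h3 := card_addable_le hM y
  rw [(mem_removable.1 hy).2] at h3
  have h4 : ((addable (M.erase y)).filter (fun a => a ::ₘ M.erase y ∈ B)).card ≤
    ((removable M).filter (· ≤ y)).card + 1 := by omega
  have h5 : (((addable (M.erase y)).filter (fun a => a ::ₘ M.erase y ∈ B)).card : ℝ) ≤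
    ((removable M).filter (· ≤ y)).card + 1 := by exact_mod_cast h4
  linarith

include hM hmax hB hb in
-- The weighted contents addable to `M.erase y` sum to 0 by `upSum_id`. Those leading into `B` are
-- negative, and all but weight `(t + 1) * b` of them are at most `-t`. The defect must compensate,
-- with contents at most `n + 1`.
theorem mul_upDegree_le {y : ℤ} (hy : y ∈ removable M) (hy0 : y < 0) (t : ℕ) :
    t * (((n + 1 : ℕ) : ℝ) * numWords n (M.erase y) - defect n M B y - (t + 1) * b) ≤
      ((n + 1 : ℕ) : ℝ) * defect n M B y := by
  set F : ℤ → ℝ := fun a => (numWords (n + 1) (a ::ₘ M.erase y) : ℝ) with hF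
  set T := (addable (M.erase y)).filter (fun a => a ::ₘ M.erase y ∈ B) with hT
  set T' := (addable (M.erase y)).filter (fun a => a ::ₘ M.erase y ∉ B) with hT'
  have hTB : ∀ a ∈ T, a ::ₘ M.erase y ∈ B := fun a ha => (mem_filter.1 ha).2
  have hTn : ∀ a ∈ T, a < 0 := fun a ha => (le_of_mem_up hM hmax hy (hTB a ha)).trans_lt hy0
  have hF0 : ∀ a, 0 ≤ F a := fun a => Nat.cast_nonneg _
  have e1 : ((n + 1 : ℕ) : ℝ) * numWords n (M.erase y) - defect n M B y = ∑ a ∈ T, F a := by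
    rw [upDegree_eq (B := B) hM hy, add_sub_cancel_right]
  have e2 : ∑ a ∈ T, (a : ℝ) * F a + ∑ a ∈ T', (a : ℝ) * F a = 0 := by
    have h := upSum_id (erase_mem_shapes hM hy)
    simp only [upSum, id] at h
    rw [hT, hT', sum_filter_add_sum_filter_not]
    simp only [hF]; exact_mod_cast h
  have e3 : ∑ a ∈ T', (a : ℝ) * F a ≤ ((n + 1 : ℕ) : ℝ) * defect n M B y := by
    rw [defect, mul_sum]
    refine sum_le_sum fun a ha => mul_le_mul_of_nonneg_right ?_ (hF0 a)
    have h1 := abs_lt_of_mem_shapes (cons_mem_shapes (erase_mem_shapes hM hy) (mem_filter.1 ha).1) a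
      (Multiset.mem_cons_self _ _)
    have h2 : a ≤ ((n + 1 : ℕ) : ℤ) := (le_abs_self a).trans h1.le
    exact_mod_cast h2
  have e4 : ∑ a ∈ T.filter (fun a => ¬ a ≤ -(t : ℤ)), F a ≤ (t + 1) * b := by
    refine (sum_numWords_le hB hb _ _ fun a ha => hTB a (mem_filter.1 ha).1).trans ?_
    refine mul_le_mul_of_nonneg_right ?_ hb.le
    have : (T.filter (fun a => ¬ a ≤ -(t : ℤ))).card ≤ (Ioo (-(t : ℤ)) 0).card := by
      refine card_le_card fun a ha => ?_
      obtain ⟨h1, h2⟩ := mem_filter.1 ha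
      rw [mem_Ioo]
      exact ⟨by omega, hTn a h1⟩
    rw [Int.card_Ioo] at this
    have h2 : (T.filter (fun a => ¬ a ≤ -(t : ℤ))).card ≤ t := by omega
    have h3 : ((T.filter (fun a => ¬ a ≤ -(t : ℤ))).card : ℝ) ≤ t := by exact_mod_cast h2
    linarith
  have e5 : t * ∑ a ∈ T.filter (fun a => a ≤ -(t : ℤ)), F a ≤ -∑ a ∈ T, (a : ℝ) * F a := by
    rw [mul_sum, ← sum_neg_distrib]
    refine (sum_le_sum (f := fun a => (t : ℝ) * F a) (g := fun a : ℤ => -((a : ℝ) * F a)) ?_).trans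
      (sum_le_sum_of_subset_of_nonneg (filter_subset _ _) ?_)
    · intro a ha
      have h1 : (t : ℤ) ≤ -a := by have := (mem_filter.1 ha).2; omega
      have h2 : (t : ℝ) ≤ -(a : ℝ) := by exact_mod_cast h1
      have := mul_le_mul_of_nonneg_right h2 (hF0 a)
      linarith
    · intro a ha _
      have h1 : (a : ℝ) ≤ 0 := by exact_mod_cast (hTn a ha).le
      have := mul_nonpos_of_nonpos_of_nonneg h1 (hF0 a)
      linarith
  rw [e1, ← sum_filter_add_sum_filter_not T (fun a => a ≤ -(t : ℤ))]
  have ht : (0 : ℝ) ≤ t := Nat.cast_nonneg t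
  have := mul_le_mul_of_nonneg_left e4 ht
  rw [mul_sub, mul_add]
  linarith

include hM hMB in
-- Cauchy–Schwarz over the pairs `(y, a)`. They give distinct shapes: `a ≠ y` because `M ∈ B`, so
-- `y` is the content whose multiplicity drops.
theorem sq_sum_defect_le :
    (∑ y ∈ removable M, defect n M B y) ^ 2 ≤ (((removable M).card : ℝ) + 1) ^ 2 *
      ∑ μ ∈ shapes (n + 1) \ B, (numWords (n + 1) μ : ℝ) ^ 2 := by
  set P := (removable M).sigma fun y =>
    (addable (M.erase y)).filter (fun a => a ::ₘ M.erase y ∉ B) with hP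
  set G : (Σ _ : ℤ, ℤ) → Multiset ℤ := fun x => x.2 ::ₘ M.erase x.1 with hG
  have hP' : ∀ x ∈ P, x.1 ∈ removable M ∧ x.2 ∈ addable M ∧ G x ∈ shapes (n + 1) \ B := by
    rintro ⟨y, a⟩ hx
    rw [hP, mem_sigma, mem_filter] at hx
    obtain ⟨hy, ha, haB⟩ := hx
    have hyM := mem_of_mem_removable hM hy
    refine ⟨hy, ?_, mem_sdiff.2 ⟨cons_mem_shapes (erase_mem_shapes hM hy) ha, haB⟩⟩
    simp only at ha haB
    rw [addable_erase hy hyM, mem_insert, mem_filter] at ha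
    rcases ha with rfl | ha
    · rw [Multiset.cons_erase hyM] at haB
      exact absurd hMB haB
    · exact ha.1
  have hinj : Set.InjOn G P := by
    rintro ⟨y, a⟩ hx ⟨z, c⟩ hx' h
    obtain ⟨hy, ha, -⟩ := hP' _ hx
    obtain ⟨hz, hc, -⟩ := hP' _ hx'
    simp only [hG] at hy ha hz hc h
    have hyz : y = z := by
      by_contra hne
      have h1 := congrArg (Multiset.count y) h
      have n1 : y ≠ a := by rintro rfl; exact not_mem_addable_of_mem_removable hy ha
      have n2 : y ≠ c := by rintro rfl; exact not_mem_addable_of_mem_removable hy hc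
      rw [Multiset.count_cons_of_ne n1, Multiset.count_cons_of_ne n2, Multiset.count_erase_self,
        Multiset.count_erase_of_ne hne] at h1
      have := Multiset.count_pos.2 (mem_of_mem_removable hM hy)
      omega
    subst hyz
    rw [Multiset.cons_inj_left] at h
    rw [h]
  have e : ∑ y ∈ removable M, defect n M B y = ∑ x ∈ P, (numWords (n + 1) (G x) : ℝ) := by
    rw [hP, sum_sigma]
    rfl
  rw [e]
  refine sq_sum_le_card_mul_sum_sq.trans ?_
  refine mul_le_mul ?_ ?_ (sum_nonneg fun _ _ => sq_nonneg _) (by positivity)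
  · have h1 : P.card ≤ (removable M ×ˢ addable M).card := by
      refine card_le_card_of_injOn (fun x => (x.1, x.2)) ?_ ?_
      · intro x hx
        have := hP' x hx
        simp [this.1, this.2.1]
      · rintro ⟨y, a⟩ _ ⟨z, c⟩ _ h
        simp at h
        simp [h]
    rw [card_product, card_addable hM] at h1
    have h2 : (P.card : ℝ) ≤ (removable M).card * ((removable M).card + 1) := by exact_mod_cast h1
    have h3 : (0 : ℝ) ≤ (removable M).card := Nat.cast_nonneg _
    nlinarith
  · rw [← sum_image (f := fun μ => (numWords (n + 1) μ : ℝ) ^ 2) hinj]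
    refine sum_le_sum_of_subset_of_nonneg ?_ fun _ _ _ => sq_nonneg _
    intro μ hμ
    obtain ⟨x, hx, rfl⟩ := mem_image.1 hμ
    exact (hP' x hx).2.2

end Extremal

/-- Quantities are measured in units of b. By `hA`, `n ≤ r ^ 2`; then the left side of `hC` is at
least `r ^ 3 / 2000`, while the right side is at most about `r ^ 3 / 10000`. -/
theorem extremal_contradiction {n r p q E t : ℝ} (hr : p + q = r) (hp : 0 ≤ p) (hq : 0 ≤ q)
    (hpq : p ^ 2 + q ^ 2 ≤ n) (hn : 2000000 ≤ n) (hE0 : 0 ≤ E) (hE : E ≤ (r + 1) / 10000)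
    (hA : n ≤ r * (r + 1) / 2 + 2 * r + E) (ht : t ≤ r / 50) (ht' : r / 50 - 1 < t)
    (hC : t * (n - (p * q + q * (q + 1) / 2 + 2 * q) - E - E - p * (t + 1)) ≤ n * E) : False := by
  have hr0 : 0 ≤ r := by linarith
  have hr1 : 1000 ≤ r := by
    by_contra! h
    nlinarith
  have hn' : n ≤ r ^ 2 := by nlinarith
  have ht1 : r / 100 ≤ t := by linarith
  have hmain : r ^ 2 / 20 ≤ n - (p * q + q * (q + 1) / 2 + 2 * q) - E - E - p * (t + 1) := by
    -- The difference of the two sides is `(3 * p - 2 * q) ^ 2 / 10`.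
    have h1 : r ^ 2 / 10 ≤ p ^ 2 + q ^ 2 - p * q - q ^ 2 / 2 := by
      subst hr
      nlinarith [sq_nonneg (3 * p - 2 * q)]
    have h2 : p * (t + 1) ≤ r * (r / 50 + 1) := by
      refine mul_le_mul ?_ ?_ ?_ ?_ <;> linarith
    have h3 : q ≤ r := by linarith
    nlinarith
  have h4 : r / 100 * (r ^ 2 / 20) ≤ n * E :=
    (mul_le_mul ht1 hmain (by positivity) (by linarith)).trans hC
  have h5 : n * E ≤ r ^ 2 * ((r + 1) / 10000) := mul_le_mul hn' hE hE0 (by positivity)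
  have h6 : 0 < r ^ 2 := by positivity
  nlinarith

theorem le_sum_sq_numWords_sdiff {n : ℕ} (hn : 2000000 ≤ n) {B : Finset (Multiset ℤ)}
    (hBn : B.Nonempty) (hBs : B ⊆ shapes n) {b : ℝ} (hb : 0 < b)
    (hB : ∀ μ ∈ B, (numWords n μ : ℝ) = b ∨ (numWords n μ : ℝ) = 2 * b ∧ μ.sum = 0) :
    b ^ 2 / 10000 ^ 2 ≤ ∑ μ ∈ shapes n \ B, (numWords n μ : ℝ) ^ 2 := by
  by_contra! hcon
  have hn' : (2000000 : ℝ) ≤ n := by exact_mod_cast hn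
  obtain ⟨M, hMB, hmax⟩ := exists_max_image B Multiset.sum hBn
  have hM := hBs hMB
  obtain ⟨n, rfl⟩ : ∃ m, n = m + 1 := ⟨n - 1, by omega⟩
  set R := removable M with hR
  set E := ∑ y ∈ R, defect n M B y with hEdef
  set Rn := R.filter (· < 0) with hRn
  set Rp := R.filter (0 ≤ ·) with hRp
  set g : ℤ → ℝ := fun y => ((n + 1 : ℕ) : ℝ) * numWords n (M.erase y) with hg
  set j : ℤ → ℝ := fun y => ((R.filter (· ≤ y)).card : ℝ) with hj
  have hE0 : 0 ≤ E := sum_nonneg fun y _ => defect_nonneg y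
  have hE : E ≤ (R.card + 1) / 10000 * b := by
    refine le_of_sq_le_sq ?_ (by positivity)
    refine (sq_sum_defect_le hM hMB).trans ?_
    calc ((R.card : ℝ) + 1) ^ 2 * ∑ μ ∈ shapes (n + 1) \ B, (numWords (n + 1) μ : ℝ) ^ 2
        ≤ ((R.card : ℝ) + 1) ^ 2 * (b ^ 2 / 10000 ^ 2) :=
          mul_le_mul_of_nonneg_left hcon.le (sq_nonneg _)
      _ = _ := by ring
  have hsplit : ∀ f : ℤ → ℝ, ∑ y ∈ R, f y = ∑ y ∈ Rn, f y + ∑ y ∈ Rp, f y := by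
    intro f
    rw [hRn, hRp, ← sum_filter_add_sum_filter_not R (· < 0)]
    simp only [not_lt]
  have hcard : (Rn.card : ℝ) + Rp.card = R.card := by
    have := hsplit fun _ => 1
    simpa using this.symm
  have hsum : ((n + 1 : ℕ) : ℝ) * b ≤ ∑ y ∈ R, g y := by
    rw [hg, ← mul_sum]
    refine mul_le_mul_of_nonneg_left ?_ (Nat.cast_nonneg _)
    have h1 : (numWords (n + 1) M : ℝ) = ∑ y ∈ R, (numWords n (M.erase y) : ℝ) := by
      exact_mod_cast numWords_succ hM
    rw [← h1]
    rcases hB M hMB with h | h <;> linarith [h]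
  have hup : ∀ y ∈ R, g y ≤ (j y + 2) * b + defect n M B y := fun y hy =>
    upDegree_le hM hmax hB hb hy
  have hjR : ∑ y ∈ R, j y = R.card * (R.card + 1) / 2 := by
    have h1 := two_mul_sum_card_filter_le R
    have h2 : 2 * ∑ y ∈ R, j y = R.card * (R.card + 1) := by
      simp only [hj]; exact_mod_cast h1
    linarith
  -- All of `Rn` lies below each element of `Rp`, which shifts the ranks by `Rn.card`.
  have hjP : ∑ y ∈ Rp, j y = Rn.card * Rp.card + Rp.card * (Rp.card + 1) / 2 := by
    have h1 := two_mul_sum_card_filter_le Rp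
    have h2 : 2 * ∑ y ∈ Rp, ((Rp.filter (· ≤ y)).card : ℝ) = Rp.card * (Rp.card + 1) := by
      exact_mod_cast h1
    have h3 : ∀ y ∈ Rp, j y = Rn.card + ((Rp.filter (· ≤ y)).card : ℝ) := by
      intro y hy
      have hy0 := (mem_filter.1 hy).2
      simp only [hj]
      norm_cast
      rw [hRn, hRp, filter_filter, ← card_union_of_disjoint]
      · congr 1
        ext x
        simp only [mem_filter, mem_union]
        constructor
        · rintro ⟨h1, h2⟩
          rcases lt_or_ge x 0 with h | h
          · exact Or.inl ⟨h1, h⟩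
          · exact Or.inr ⟨h1, h, h2⟩
        · rintro (⟨h1, h2⟩ | ⟨h1, -, h2⟩)
          · exact ⟨h1, by omega⟩
          · exact ⟨h1, h2⟩
      · rw [disjoint_left]
        intro x hx hx'
        simp only [mem_filter] at hx hx'
        omega
    rw [sum_congr rfl h3, sum_add_distrib, sum_const, nsmul_eq_mul]
    linarith
  have hdle : ∀ S ⊆ R, ∑ y ∈ S, defect n M B y ≤ E := fun S hS =>
    sum_le_sum_of_subset_of_nonneg hS fun y _ _ => defect_nonneg y
  have hA : ((n + 1 : ℕ) : ℝ) * b ≤ (R.card * (R.card + 1) / 2 + 2 * R.card) * b + E := by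
    refine hsum.trans ((sum_le_sum hup).trans ?_)
    rw [sum_add_distrib, ← sum_mul, sum_add_distrib, hjR, sum_const, nsmul_eq_mul]
    linarith
  have hBd : ∑ y ∈ Rp, g y ≤
      (Rn.card * Rp.card + Rp.card * (Rp.card + 1) / 2 + 2 * Rp.card) * b + E := by
    refine (sum_le_sum fun y hy => hup y (mem_filter.1 hy).1).trans ?_
    rw [sum_add_distrib, ← sum_mul, sum_add_distrib, hjP, sum_const, nsmul_eq_mul]
    linarith [hdle Rp (filter_subset _ _)]
  -- The cutoff has the order of `R.card`, but is small enough that the discarded weight does not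
  -- spoil the quadratic bound `r ^ 2 / 10`.
  set t := ⌊(R.card : ℝ) / 50⌋₊ with ht
  have hC : t * (∑ y ∈ Rn, g y - E - Rn.card * ((t + 1) * b)) ≤ ((n + 1 : ℕ) : ℝ) * E := by
    have h1 := sum_le_sum fun y hy =>
      mul_upDegree_le hM hmax hB hb (mem_filter.1 hy).1 (mem_filter.1 hy).2 t (y := y)
    rw [← mul_sum, ← mul_sum, sum_sub_distrib, sum_sub_distrib, sum_const, nsmul_eq_mul] at h1
    have h2 := hdle Rn (filter_subset _ _)
    have h3 := mul_le_mul_of_nonneg_left h2 (Nat.cast_nonneg (α := ℝ) (n + 1))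
    refine le_trans ?_ (h1.trans h3)
    refine mul_le_mul_of_nonneg_left ?_ (Nat.cast_nonneg _)
    have : ∑ y ∈ Rn, g y = ∑ y ∈ Rn, ((n + 1 : ℕ) : ℝ) * numWords n (M.erase y) := rfl
    linarith
  have hpq' : (Rn.card : ℝ) ^ 2 + (Rp.card : ℝ) ^ 2 ≤ ((n + 1 : ℕ) : ℝ) := by
    exact_mod_cast sq_card_removable_le hM
  refine extremal_contradiction (n := ((n + 1 : ℕ) : ℝ)) (r := R.card) (p := Rn.card)
    (q := Rp.card) (E := E / b) (t := t) hcard (Nat.cast_nonneg _) (Nat.cast_nonneg _)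
    hpq' hn' (div_nonneg hE0 hb.le) ?_ ?_ ?_ ?_ ?_
  · rw [div_le_iff₀ hb]; exact hE
  · rw [← mul_le_mul_iff_of_pos_right hb, add_mul, div_mul_cancel₀ _ hb.ne']
    exact hA
  · exact Nat.floor_le (div_nonneg (Nat.cast_nonneg _) (by norm_num))
  · exact Nat.sub_one_lt_floor _
  · rw [← mul_le_mul_iff_of_pos_right hb, mul_assoc, mul_assoc, div_mul_cancel₀ _ hb.ne']
    refine le_trans (mul_le_mul_of_nonneg_left ?_ (Nat.cast_nonneg t)) hC
    have h1 := hsplit g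
    rw [sub_mul, sub_mul, sub_mul, sub_mul, div_mul_cancel₀ _ hb.ne']
    linarith

/-! ### The Coxeter presentation of the symmetric group -/

section TypeA

variable {W : Type*} [Group W]

/-- The Coxeter relations of type `A` for the elements `s i` with `i < N`. -/
structure CoxeterA (N : ℕ) (s : ℕ → W) : Prop where
  mul_self : ∀ i < N, s i * s i = 1
  comm : ∀ i j, i + 1 < j → j < N → s i * s j = s j * s i
  braid : ∀ i, i + 1 < N → s i * s (i + 1) * s i = s (i + 1) * s i * s (i + 1)

/-- The product `s k * s (k - 1) * ⋯` of `m` factors. -/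
def descProd (s : ℕ → W) (k : ℕ) : ℕ → W
  | 0 => 1
  | m + 1 => descProd s k m * s (k - m)

variable {N : ℕ} {s : ℕ → W} (hs : CoxeterA N s)

include hs in
theorem descProd_mul_of_lt {k i m : ℕ} (hk : k < N) (h : i + m < k) :
    descProd s k m * s i = s i * descProd s k m := by
  induction m with
  | zero => simp [descProd]
  | succ m ih =>
    rw [descProd, mul_assoc, ← hs.comm i (k - m) (by omega) (by omega), ← mul_assoc,
      ih (by omega), mul_assoc]

include hs in
-- Moving left, `s (i + 1)` commutes with the factors until it meets `s (i + 1) * s i`; the braid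
-- relation turns it into `s i`, which commutes with the rest.
theorem descProd_mul_of_gt {k i m : ℕ} (hk : k < N) (hm : m ≤ k + 1) (hi : i + 1 ≤ k)
    (h : k < i + m) : descProd s k m * s (i + 1) = s i * descProd s k m := by
  induction m with
  | zero => omega
  | succ m ih =>
    by_cases h' : k < i + m
    · rw [descProd, mul_assoc, hs.comm (k - m) (i + 1) (by omega) (by omega), ← mul_assoc,
        ih (by omega) h', mul_assoc]
    · obtain ⟨m, rfl⟩ : ∃ l, m = l + 1 := ⟨m - 1, by omega⟩
      have e1 : k - m = i + 1 := by omega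
      have e2 : k - (m + 1) = i := by omega
      rw [descProd, descProd, e1, e2, mul_assoc, mul_assoc, ← mul_assoc (s (i + 1)),
        ← hs.braid i (by omega), mul_assoc, ← mul_assoc, descProd_mul_of_lt hs hk (by omega),
        mul_assoc, mul_assoc]

include hs in
-- Inductively, the `k + 2` products `descProd s k m` meet all right cosets of the subgroup
-- generated by the first `k` generators, since the union of their cosets is stable under right
-- multiplication by the generators.
theorem card_closure_le {k : ℕ} (hk : k ≤ N) :
    Finite (Subgroup.closure (s '' Set.Iio k)) ∧
      Nat.card (Subgroup.closure (s '' Set.Iio k)) ≤ (k + 1).factorial := by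
  induction k with
  | zero =>
    have : s '' Set.Iio 0 = ∅ := by simp
    rw [this, Subgroup.closure_empty]
    exact ⟨inferInstance, by simp⟩
  | succ k ih =>
    obtain ⟨hfin, hcard⟩ := ih (by omega)
    set H := Subgroup.closure (s '' Set.Iio k) with hH
    have hmem : ∀ i < k, s i ∈ H := fun i hi => Subgroup.subset_closure ⟨i, hi, rfl⟩
    set f : H × Fin (k + 2) → W := fun x => x.1 * descProd s k x.2 with hf
    have hstep : ∀ x ∈ Set.range f, ∀ i < k + 1, x * s i ∈ Set.range f := by
      rintro _ ⟨⟨⟨h, hh⟩, ⟨m, hm⟩⟩, rfl⟩ i hi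
      simp only [hf]
      rcases lt_trichotomy (i + m) k with hlt | heq | hgt
      · refine ⟨⟨⟨h * s i, H.mul_mem hh (hmem i (by omega))⟩, ⟨m, hm⟩⟩, ?_⟩
        simp only
        rw [mul_assoc, mul_assoc, descProd_mul_of_lt hs (by omega) hlt]
      · refine ⟨⟨⟨h, hh⟩, ⟨m + 1, by omega⟩⟩, ?_⟩
        simp only [descProd]
        rw [mul_assoc, show k - m = i by omega]
      · by_cases h' : i + m = k + 1
        · obtain ⟨m, rfl⟩ : ∃ l, m = l + 1 := ⟨m - 1, by omega⟩
          refine ⟨⟨⟨h, hh⟩, ⟨m, by omega⟩⟩, ?_⟩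
          simp only [descProd]
          rw [show k - m = i by omega, mul_assoc, mul_assoc, hs.mul_self i (by omega), mul_one]
        · obtain ⟨i, rfl⟩ : ∃ l, i = l + 1 := ⟨i - 1, by omega⟩
          refine ⟨⟨⟨h * s i, H.mul_mem hh (hmem i (by omega))⟩, ⟨m, hm⟩⟩, ?_⟩
          simp only
          rw [mul_assoc, mul_assoc, descProd_mul_of_gt hs (by omega) (by omega) (by omega)
            (by omega)]
    have hsub : (Subgroup.closure (s '' Set.Iio (k + 1)) : Set W) ⊆ Set.range f := by
      intro x hx
      induction hx using Subgroup.closure_induction_right with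
      | one => exact ⟨⟨1, 0⟩, by simp [hf, descProd]⟩
      | mul_right x _ y hy ih =>
        obtain ⟨i, hi, rfl⟩ := hy
        exact hstep x ih i hi
      | mul_inv_cancel x _ y hy ih =>
        obtain ⟨i, hi, rfl⟩ := hy
        rw [inv_eq_of_mul_eq_one_right (hs.mul_self i (lt_of_lt_of_le hi hk))]
        exact hstep x ih i hi
    have hrf : (Set.range f).Finite := Set.finite_range f
    refine ⟨hrf.subset hsub, ?_⟩
    calc Nat.card (Subgroup.closure (s '' Set.Iio (k + 1)))
        ≤ Nat.card (Set.range f) := Nat.card_mono hrf hsub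
      _ ≤ Nat.card (H × Fin (k + 2)) := Finite.card_range_le f
      _ = (k + 2) * Nat.card H := by rw [Nat.card_prod, Nat.card_fin, mul_comm]
      _ ≤ (k + 2) * (k + 1).factorial := Nat.mul_le_mul_left _ hcard
      _ = _ := (Nat.factorial_succ _).symm

end TypeA

/-- The adjacent transposition of `i` and `i + 1`. -/
def adjSwap (N i : ℕ) : Equiv.Perm (Fin (N + 1)) :=
  if h : i < N then Equiv.swap (Fin.castSucc ⟨i, h⟩) (Fin.succ ⟨i, h⟩) else 1

theorem swap_braid {α : Type*} [DecidableEq α] {i j k : α} (hij : i ≠ j) (hjk : j ≠ k)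
    (hik : i ≠ k) : Equiv.swap i j * Equiv.swap j k * Equiv.swap i j =
      Equiv.swap j k * Equiv.swap i j * Equiv.swap j k := by
  have h := Equiv.swap_mul_swap_mul_swap hjk.symm hik.symm
  rw [Equiv.swap_comm j i, Equiv.swap_comm k j, Equiv.swap_comm i k] at h
  rw [h, Equiv.swap_mul_swap_mul_swap hij hik]

theorem coxeterA_adjSwap (N : ℕ) : CoxeterA N (adjSwap N) where
  mul_self i hi := by simp [adjSwap, hi]
  comm i j hij hj := by
    have hi : i < N := by omega
    simp only [adjSwap, hi, hj, dif_pos]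
    refine (Equiv.Perm.Disjoint.commute ?_)
    rw [Equiv.Perm.disjoint_iff_disjoint_support, Equiv.Perm.support_swap, Equiv.Perm.support_swap]
    · simp [Fin.ext_iff]; omega
    · simp [Fin.ext_iff]
    · simp [Fin.ext_iff]
  braid i hi := by
    have hi' : i < N := by omega
    simp only [adjSwap, hi, hi', dif_pos]
    exact swap_braid (by simp [Fin.ext_iff]) (by simp [Fin.ext_iff])
      (by simp [Fin.ext_iff]; omega)

/-- The subgroup generated by the pairs `(adjSwap N i, t i)` projects onto the symmetric group and
is no larger by `card_closure_le`, so it is the graph of a homomorphism. -/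
theorem exists_monoidHom_of_coxeterA {G : Type*} [Group G] {N : ℕ} {t : ℕ → G}
    (ht : CoxeterA N t) :
    ∃ φ : Equiv.Perm (Fin (N + 1)) →* G, ∀ i < N, φ (adjSwap N i) = t i := by
  set u : ℕ → Equiv.Perm (Fin (N + 1)) × G := fun i => (adjSwap N i, t i) with hu
  have hσ := coxeterA_adjSwap N
  have hcu : CoxeterA N u :=
    ⟨fun i hi => Prod.ext (hσ.mul_self i hi) (ht.mul_self i hi),
      fun i j h h' => Prod.ext (hσ.comm i j h h') (ht.comm i j h h'),
      fun i h => Prod.ext (hσ.braid i h) (ht.braid i h)⟩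
  obtain ⟨hfin, hcard⟩ := card_closure_le hcu le_rfl
  set H := Subgroup.closure (u '' Set.Iio N) with hH
  have hmem : ∀ i < N, u i ∈ H := fun i hi => Subgroup.subset_closure ⟨i, hi, rfl⟩
  set π : H →* Equiv.Perm (Fin (N + 1)) := (MonoidHom.fst _ _).comp H.subtype with hπ
  have hsurj : Function.Surjective π := by
    rw [← MonoidHom.mrange_eq_top, eq_top_iff, ← Equiv.Perm.mclosure_swap_castSucc_succ N,
      Submonoid.closure_le]
    rintro _ ⟨i, rfl⟩
    exact ⟨⟨u i, hmem i i.2⟩, by simp [hπ, hu, adjSwap]; rfl⟩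
  have hbij : Function.Bijective π := by
    refine hsurj.bijective_of_nat_card_le ?_
    rw [Nat.card_perm, Nat.card_fin]
    exact hcard
  set e := MulEquiv.ofBijective π hbij with he
  refine ⟨((MonoidHom.snd _ _).comp H.subtype).comp e.symm.toMonoidHom, fun i hi => ?_⟩
  have : e.symm (adjSwap N i) = ⟨u i, hmem i hi⟩ := by
    rw [MulEquiv.symm_apply_eq]
    rfl
  simp [this, hu]

/-! ### Admissible transpositions of words -/

theorem tail_comp_swap_zero {n : ℕ} (w : Fin (n + 1 + 1) → ℤ) :
    Fin.tail (Fin.tail (w ∘ Equiv.swap 0 1)) = Fin.tail (Fin.tail w) := by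
  funext k
  simp only [Fin.tail, Function.comp]
  rw [Equiv.swap_apply_of_ne_of_ne] <;> simp [Fin.ext_iff]

theorem tail_comp_swap_succ {n : ℕ} (w : Fin (n + 1) → ℤ) (i j : Fin n) :
    Fin.tail (w ∘ Equiv.swap i.succ j.succ) = Fin.tail w ∘ Equiv.swap i j := by
  funext k
  simp only [Fin.tail, Function.comp]
  congr 1
  rw [Equiv.swap_apply_def, Equiv.swap_apply_def]
  simp only [Fin.succ_inj]
  split_ifs <;> rfl

theorem ne_of_mem_words {N : ℕ} {w : Fin (N + 1) → ℤ} (hw : w ∈ words (N + 1)) (i : Fin N) :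
    w i.castSucc ≠ w i.succ := by
  induction N with
  | zero => exact i.elim0
  | succ N ih =>
    rw [mem_words_succ] at hw
    refine Fin.cases ?_ (fun i => ?_) i
    · rw [mem_words_succ, shape_succ (Fin.tail w), mem_addable, mem_addable, bead_cons,
        bead_cons] at hw
      intro h
      have h' : Fin.tail w 0 = w 0 := h.symm
      rw [h'] at hw
      simp at hw
      omega
    · exact ih hw.1 i

/-- Between two moves of a bead from c to c + 1, site c must be refilled and site c + 1 vacated,
which takes two moves. -/
theorem ne_of_mem_words' {N : ℕ} {w : Fin (N + 1 + 1) → ℤ} (hw : w ∈ words (N + 1 + 1))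
    (i : Fin N) : w i.castSucc.castSucc ≠ w i.succ.succ := by
  induction N with
  | zero => exact i.elim0
  | succ N ih =>
    refine Fin.cases ?_ (fun i => ?_) i
    · rw [mem_words_succ, mem_words_succ, mem_words_succ, shape_succ (Fin.tail w),
        shape_succ (Fin.tail (Fin.tail w))] at hw
      obtain ⟨⟨⟨-, h1⟩, h2⟩, h3⟩ := hw
      intro h
      have h' : Fin.tail (Fin.tail w) 0 = w 0 := h.symm
      rw [h'] at h1 h2 h3
      rw [mem_addable] at h1 h2 h3
      simp only [bead_cons] at h1 h2 h3
      have e1 : Fin.tail w 0 = w 0 - 1 := by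
        by_contra hne
        obtain ⟨h3, -⟩ := h3
        simp only [if_neg (show w 0 ≠ Fin.tail w 0 + 1 by omega)] at h3
        split_ifs at h3 <;> omega
      rw [e1] at h3
      simp at h3
      omega
    · exact ih (mem_words_succ.1 hw).1 i

/-- The contents differ by at least 2, so the two moves involve disjoint pairs of sites and commute.
-/
theorem comp_swap_mem_words {N : ℕ} {w : Fin (N + 1) → ℤ} (hw : w ∈ words (N + 1)) (i : Fin N)
    (h1 : w i.castSucc - w i.succ ≠ 1) (h2 : w i.castSucc - w i.succ ≠ -1) :
    w ∘ Equiv.swap i.castSucc i.succ ∈ words (N + 1) := by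
  induction N with
  | zero => exact i.elim0
  | succ N ih =>
    revert h1 h2
    refine Fin.cases ?_ (fun i => ?_) i
    · intro h1 h2
      have hne := ne_of_mem_words hw 0
      change w 0 - w 1 ≠ 1 at h1
      change w 0 - w 1 ≠ -1 at h2
      change w 0 ≠ w 1 at hne
      change w ∘ Equiv.swap 0 1 ∈ _
      rw [mem_words_succ, mem_words_succ, shape_succ (Fin.tail w), mem_addable, mem_addable,
        bead_cons, bead_cons] at hw
      rw [mem_words_succ, mem_words_succ, shape_succ (Fin.tail (w ∘ Equiv.swap 0 1)), mem_addable, mem_addable,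
        bead_cons, bead_cons, tail_comp_swap_zero]
      have e1 : Fin.tail (w ∘ Equiv.swap 0 1) 0 = w 0 := by simp [Fin.tail]
      have e2 : (w ∘ Equiv.swap 0 1) 0 = w 1 := by simp
      have e3 : Fin.tail w 0 = w 1 := rfl
      rw [e1, e2]
      rw [e3] at hw
      obtain ⟨⟨h4, h5, h6⟩, h7, h8⟩ := hw
      rw [if_neg (by omega), if_neg (by omega)] at h7
      rw [if_neg (by omega), if_neg (by omega)] at h8
      rw [if_neg (by omega), if_neg (by omega), if_neg (by omega), if_neg (by omega)]
      refine ⟨⟨h4, by omega, by omega⟩, by omega, by omega⟩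
    · intro h1 h2
      rw [mem_words_succ] at hw ⊢
      rw [← Fin.succ_castSucc, tail_comp_swap_succ, shape_comp_perm]
      refine ⟨ih hw.1 i h1 h2, ?_⟩
      rw [Function.comp, Equiv.swap_apply_of_ne_of_ne (Fin.succ_ne_zero _).symm
        (Fin.succ_ne_zero _).symm]
      exact hw.2

theorem last_of_mem_words {N : ℕ} {w : Fin (N + 1) → ℤ} (hw : w ∈ words (N + 1)) :
    w (Fin.last N) = 0 := by
  induction N with
  | zero =>
    have h := (mem_words_succ.1 hw).2
    have e : shape (Fin.tail w) = 0 := rfl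
    have e2 : addable 0 = {0} := by decide
    rw [e, e2, mem_singleton] at h
    exact h
  | succ N ih => exact ih (mem_words_succ.1 hw).1

/-! ### Young's orthogonal form -/

/-- The off-diagonal entry of the orthogonal form; it vanishes exactly at the differences ±1
excluded in `comp_swap_mem_words`. -/
noncomputable def offCoeff (d : ℤ) : ℂ := (Real.sqrt (1 - ((d : ℝ)⁻¹) ^ 2) : ℝ)

theorem offCoeff_sq (d : ℤ) : offCoeff d * offCoeff d = 1 - ((d : ℂ)⁻¹) ^ 2 := by
  have h : 0 ≤ 1 - ((d : ℝ)⁻¹) ^ 2 := by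
    rcases eq_or_ne d 0 with rfl | hd
    · simp
    · have h1 : (1 : ℝ) ≤ |(d : ℝ)| := by exact_mod_cast Int.one_le_abs hd
      have h2 : |((d : ℝ)⁻¹)| ≤ 1 := by rw [abs_inv]; exact inv_le_one_of_one_le₀ h1
      have := (sq_le_one_iff_abs_le_one _).2 h2
      linarith
  rw [offCoeff, ← Complex.ofReal_mul, Real.mul_self_sqrt h]
  push_cast
  rfl

theorem offCoeff_neg (d : ℤ) : offCoeff (-d) = offCoeff d := by simp [offCoeff]

theorem offCoeff_one : offCoeff 1 = 0 := by simp [offCoeff]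

theorem offCoeff_ne_zero {d : ℤ} (h1 : d ≠ 1) (h2 : d ≠ -1) : offCoeff d ≠ 0 := by
  intro h
  have h3 := offCoeff_sq d
  rw [h, mul_zero, eq_comm, sub_eq_zero, eq_comm, inv_pow, inv_eq_one, sq] at h3
  have h4 : d * d = 1 := by exact_mod_cast h3
  rcases Int.eq_one_or_neg_one_of_mul_eq_one h4 with h5 | h5
  exacts [h1 h5, h2 h5]

variable {n : ℕ}

/-- Acting on functions of all integer words allows the Coxeter relations to be checked without
asking which swaps are admissible. -/
noncomputable def formalOp (i j : Fin n) (Φ : (Fin n → ℤ) → ℂ) (w : Fin n → ℤ) : ℂ :=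
  ((w i - w j : ℤ) : ℂ)⁻¹ * Φ w + offCoeff (w i - w j) * Φ (w ∘ Equiv.swap i j)

theorem formalOp_formalOp (i j : Fin n) (Φ : (Fin n → ℤ) → ℂ) (w : Fin n → ℤ) :
    formalOp i j (formalOp i j Φ) w = Φ w := by
  have e : (w ∘ Equiv.swap i j) ∘ Equiv.swap i j = w := by
    funext k; simp
  have e1 : w j - w i = -(w i - w j) := by ring
  simp only [formalOp, e, Function.comp, Equiv.swap_apply_left, Equiv.swap_apply_right]
  have := offCoeff_sq (w i - w j)
  simp only [e1, offCoeff_neg, Int.cast_neg, inv_neg]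
  linear_combination Φ w * this

theorem formalOp_comm {i j k l : Fin n} (h1 : i ≠ k) (h2 : i ≠ l) (h3 : j ≠ k) (h4 : j ≠ l)
    (Φ : (Fin n → ℤ) → ℂ) (w : Fin n → ℤ) :
    formalOp i j (formalOp k l Φ) w = formalOp k l (formalOp i j Φ) w := by
  have e : (w ∘ Equiv.swap i j) ∘ Equiv.swap k l = (w ∘ Equiv.swap k l) ∘ Equiv.swap i j := by
    have : Commute (Equiv.swap i j) (Equiv.swap k l) := by
      refine Equiv.Perm.Disjoint.commute ?_
      intro x
      by_cases hx : x = i ∨ x = j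
      · right
        rcases hx with rfl | rfl
        · exact Equiv.swap_apply_of_ne_of_ne h1 h2
        · exact Equiv.swap_apply_of_ne_of_ne h3 h4
      · left
        rw [not_or] at hx
        exact Equiv.swap_apply_of_ne_of_ne hx.1 hx.2
    funext x
    exact congrArg w (Equiv.congr_fun this.eq x)
  simp only [formalOp, e, Function.comp_apply, Equiv.swap_apply_of_ne_of_ne h1 h2,
    Equiv.swap_apply_of_ne_of_ne h3 h4, Equiv.swap_apply_of_ne_of_ne h1.symm h3.symm,
    Equiv.swap_apply_of_ne_of_ne h2.symm h4.symm]
  ring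

theorem formalOp_braid {i j k : Fin n} (hij : i ≠ j) (hjk : j ≠ k) (hik : i ≠ k)
    (Φ : (Fin n → ℤ) → ℂ) (w : Fin n → ℤ) (h1 : w i ≠ w j) (h2 : w j ≠ w k) (h3 : w i ≠ w k) :
    formalOp i j (formalOp j k (formalOp i j Φ)) w =
      formalOp j k (formalOp i j (formalOp j k Φ)) w := by
  have e1 : (w ∘ Equiv.swap i j) ∘ Equiv.swap i j = w := by funext; simp
  have e2 : (w ∘ Equiv.swap j k) ∘ Equiv.swap j k = w := by funext; simp
  have e3 : ((w ∘ Equiv.swap i j) ∘ Equiv.swap j k) ∘ Equiv.swap i j =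
      ((w ∘ Equiv.swap j k) ∘ Equiv.swap i j) ∘ Equiv.swap j k := by
    funext x
    exact congrArg w (Equiv.congr_fun (swap_braid hij hjk hik) x)
  simp only [formalOp, e1, e2, e3, Function.comp_apply, Equiv.swap_apply_left,
    Equiv.swap_apply_right, Equiv.swap_apply_of_ne_of_ne hij hik,
    Equiv.swap_apply_of_ne_of_ne hik.symm hjk.symm]
  have n1 : w j - w i = -(w i - w j) := by ring
  have n2 : w k - w j = -(w j - w k) := by ring
  have q1 := offCoeff_sq (w i - w j)
  have q2 := offCoeff_sq (w j - w k)
  simp only [n1, n2, offCoeff_neg]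
  -- Partial fractions; this is where distinctness of the three contents enters.
  have c : (((w i - w j : ℤ) : ℂ))⁻¹ * ((w j - w k : ℤ) : ℂ)⁻¹ =
      ((w i - w k : ℤ) : ℂ)⁻¹ * (((w i - w j : ℤ) : ℂ)⁻¹ + ((w j - w k : ℤ) : ℂ)⁻¹) := by
    have z1 : ((w i - w j : ℤ) : ℂ) ≠ 0 := by exact_mod_cast sub_ne_zero.2 h1
    have z2 : ((w j - w k : ℤ) : ℂ) ≠ 0 := by exact_mod_cast sub_ne_zero.2 h2
    have z3 : ((w i - w k : ℤ) : ℂ) ≠ 0 := by exact_mod_cast sub_ne_zero.2 h3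
    field_simp
    push_cast
    ring
  have c1 : (((-(w i - w j) : ℤ)) : ℂ)⁻¹ = -((w i - w j : ℤ) : ℂ)⁻¹ := by
    rw [Int.cast_neg, inv_neg]
  have c2 : (((-(w j - w k) : ℤ)) : ℂ)⁻¹ = -((w j - w k : ℤ) : ℂ)⁻¹ := by
    rw [Int.cast_neg, inv_neg]
  rw [c1, c2]
  generalize (((w i - w j : ℤ)) : ℂ)⁻¹ = x at *
  generalize (((w j - w k : ℤ)) : ℂ)⁻¹ = y at *
  generalize (((w i - w k : ℤ)) : ℂ)⁻¹ = z at *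
  generalize offCoeff (w i - w j) = gx at *
  generalize offCoeff (w j - w k) = gy at *
  generalize offCoeff (w i - w k) = gz at *
  generalize Φ w = p1
  generalize Φ (w ∘ Equiv.swap i j) = p2
  generalize Φ (w ∘ Equiv.swap j k) = p3
  linear_combination (z * p1) * q1 - (z * p1) * q2 + (x * p1 - y * p1 + gx * p2 - gy * p3) * c

/-! ### The representation of the symmetric group attached to a shape -/

/-- The words (standard Young tableaux) of shape `M`. -/
def tableaux (n : ℕ) (M : Multiset ℤ) : Finset (Fin n → ℤ) := (words n).filter (shape · = M)

theorem mem_tableaux {n : ℕ} {M : Multiset ℤ} {w : Fin n → ℤ} :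
    w ∈ tableaux n M ↔ w ∈ words n ∧ shape w = M := mem_filter

noncomputable def extend {n : ℕ} {M : Multiset ℤ} (φ : tableaux n M → ℂ) (w : Fin n → ℤ) : ℂ :=
  if h : w ∈ tableaux n M then φ ⟨w, h⟩ else 0

theorem extend_coe {n : ℕ} {M : Multiset ℤ} (φ : tableaux n M → ℂ) (w : tableaux n M) :
    extend φ w = φ w := by simp [extend]

variable {N : ℕ} {M : Multiset ℤ}

theorem comp_swap_mem_tableaux {w : Fin (N + 1) → ℤ} (hw : w ∈ tableaux (N + 1) M) (i : Fin N)
    (h1 : w i.castSucc - w i.succ ≠ 1) (h2 : w i.castSucc - w i.succ ≠ -1) :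
    w ∘ Equiv.swap i.castSucc i.succ ∈ tableaux (N + 1) M := by
  rw [mem_tableaux] at hw ⊢
  exact ⟨comp_swap_mem_words hw.1 i h1 h2, by rw [shape_comp_perm, hw.2]⟩

/-- The action of an adjacent transposition in Young's orthogonal form. -/
noncomputable def youngOp (M : Multiset ℤ) (i : Fin N) :
    (tableaux (N + 1) M → ℂ) →ₗ[ℂ] (tableaux (N + 1) M → ℂ) where
  toFun φ w := formalOp i.castSucc i.succ (extend φ) w
  map_add' φ ψ := by
    funext w
    have h : ∀ v, extend (φ + ψ) v = extend φ v + extend ψ v := by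
      intro v; by_cases hv : v ∈ tableaux (N + 1) M <;> simp [extend, hv]
    simp only [formalOp, h, Pi.add_apply]
    ring
  map_smul' c φ := by
    funext w
    have h : ∀ v, extend (c • φ) v = c * extend φ v := by
      intro v; by_cases hv : v ∈ tableaux (N + 1) M <;> simp [extend, hv]
    simp only [formalOp, h, Pi.smul_apply, smul_eq_mul, RingHom.id_apply]
    ring

/-- A swap can lead from a non-tableau to a tableau only if the contents differ by ±1, and then its
coefficient vanishes. -/
theorem extend_youngOp (i : Fin N) (φ : tableaux (N + 1) M → ℂ) :
    extend (youngOp M i φ) = formalOp i.castSucc i.succ (extend φ) := by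
  funext w
  by_cases hw : w ∈ tableaux (N + 1) M
  · exact extend_coe (youngOp M i φ) ⟨w, hw⟩
  · have h0 : ∀ ψ : tableaux (N + 1) M → ℂ, extend ψ w = 0 := fun ψ => dif_neg hw
    rw [h0, formalOp, h0, mul_zero, zero_add]
    by_cases h1 : w i.castSucc - w i.succ = 1
    · rw [h1, offCoeff_one, zero_mul]
    by_cases h2 : w i.castSucc - w i.succ = -1
    · rw [h2, offCoeff_neg, offCoeff_one, zero_mul]
    rw [extend, dif_neg, mul_zero]
    intro h
    have h3 := comp_swap_mem_tableaux h i (by simp; omega) (by simp; omega)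
    have e : (w ∘ Equiv.swap i.castSucc i.succ) ∘ Equiv.swap i.castSucc i.succ = w := by
      funext k; simp
    exact hw (e ▸ h3)

theorem youngOp_apply (i : Fin N) (φ : tableaux (N + 1) M → ℂ) (w : tableaux (N + 1) M) :
    youngOp M i φ w = formalOp i.castSucc i.succ (extend φ) w := rfl

theorem youngOp_mul_self (i : Fin N) : youngOp M i * youngOp M i = 1 := by
  refine LinearMap.ext fun φ => funext fun w => ?_
  rw [Module.End.mul_apply, youngOp_apply, extend_youngOp, formalOp_formalOp, extend_coe]
  rfl

theorem youngOp_comm {i j : Fin N} (h : (i : ℕ) + 1 < j) :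
    youngOp M i * youngOp M j = youngOp M j * youngOp M i := by
  refine LinearMap.ext fun φ => funext fun w => ?_
  rw [Module.End.mul_apply, Module.End.mul_apply, youngOp_apply, youngOp_apply, extend_youngOp,
    extend_youngOp, formalOp_comm]
  all_goals rw [Ne, Fin.ext_iff]; simp; omega

theorem youngOp_braid (i : Fin N) (hi : (i : ℕ) + 1 < N) :
    youngOp M i * youngOp M ⟨i + 1, hi⟩ * youngOp M i =
      youngOp M ⟨i + 1, hi⟩ * youngOp M i * youngOp M ⟨i + 1, hi⟩ := by
  obtain ⟨N, rfl⟩ : ∃ m, N = m + 1 := ⟨N - 1, by omega⟩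
  refine LinearMap.ext fun φ => funext fun w => ?_
  obtain ⟨j, rfl⟩ : ∃ j : Fin N, i = j.castSucc := ⟨⟨i, by omega⟩, rfl⟩
  have hj : (⟨(j.castSucc : Fin (N + 1)) + 1, hi⟩ : Fin (N + 1)) = j.succ := rfl
  have hw := (mem_tableaux.1 w.2).1
  rw [hj]
  simp only [Module.End.mul_apply]
  rw [youngOp_apply, youngOp_apply, extend_youngOp, extend_youngOp, extend_youngOp,
    extend_youngOp, Fin.succ_castSucc]
  refine formalOp_braid ?_ ?_ ?_ _ _ (ne_of_mem_words hw j.castSucc) (ne_of_mem_words hw j.succ)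
    (ne_of_mem_words' hw j)
  all_goals rw [Ne, Fin.ext_iff]; simp only [Fin.val_castSucc, Fin.val_succ]; omega

noncomputable def youngUnit (M : Multiset ℤ) (N i : ℕ) :
    ((tableaux (N + 1) M → ℂ) →ₗ[ℂ] (tableaux (N + 1) M → ℂ))ˣ :=
  if h : i < N then ⟨youngOp M ⟨i, h⟩, youngOp M ⟨i, h⟩, youngOp_mul_self _, youngOp_mul_self _⟩
  else 1

theorem coxeterA_youngUnit (M : Multiset ℤ) (N : ℕ) : CoxeterA N (youngUnit M N) where
  mul_self i hi := by
    ext1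
    simp only [youngUnit, hi, dif_pos]
    exact youngOp_mul_self _
  comm i j hij hj := by
    have hi : i < N := by omega
    ext1
    simp only [youngUnit, hi, hj, dif_pos]
    exact youngOp_comm hij
  braid i hi := by
    have hi' : i < N := by omega
    ext1
    simp only [youngUnit, hi, hi', dif_pos]
    exact youngOp_braid ⟨i, hi'⟩ hi

noncomputable def youngRep (M : Multiset ℤ) (N : ℕ) :
    Representation ℂ (Equiv.Perm (Fin (N + 1))) (tableaux (N + 1) M → ℂ) :=
  (Units.coeHom _).comp (exists_monoidHom_of_coxeterA (coxeterA_youngUnit M N)).choose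

theorem youngRep_swap (M : Multiset ℤ) (i : Fin N) :
    youngRep M N (Equiv.swap i.castSucc i.succ) = youngOp M i := by
  have h := (exists_monoidHom_of_coxeterA (coxeterA_youngUnit M N)).choose_spec i i.2
  have e : adjSwap N i = Equiv.swap i.castSucc i.succ := by simp [adjSwap]
  rw [e] at h
  rw [youngRep, MonoidHom.comp_apply, h]
  simp [youngUnit]

theorem finrank_youngRep (M : Multiset ℤ) (N : ℕ) :
    Module.finrank ℂ (tableaux (N + 1) M → ℂ) = numWords (N + 1) M := by
  rw [Module.finrank_fintype_fun_eq_card, Fintype.card_coe, numWords, tableaux]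

/-- The Jucys–Murphy elements act diagonally. -/
theorem sum_youngRep_swap (p : Fin (N + 1)) (φ : tableaux (N + 1) M → ℂ)
    (w : tableaux (N + 1) M) :
    ∑ q ∈ Ioi p, youngRep M N (Equiv.swap p q) φ w = (w : Fin (N + 1) → ℤ) p * φ w := by
  induction p using Fin.reverseInduction generalizing φ w with
  | last =>
    have h := last_of_mem_words (mem_tableaux.1 w.2).1
    have e : Ioi (Fin.last N) = ∅ := by
      ext x; simp [Fin.le_last]
    rw [e, sum_empty, h]
    simp
  | cast i ih =>
    have e : Ioi i.castSucc = insert i.succ (Ioi i.succ) := by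
      ext x
      rw [mem_insert, mem_Ioi, mem_Ioi, Fin.lt_def, Fin.lt_def, Fin.ext_iff]
      simp
      omega
    set s := Equiv.swap i.castSucc i.succ with hs
    set ψ := youngOp M i φ with hψ
    have hφ : φ = youngOp M i ψ := by
      have := LinearMap.congr_fun (youngOp_mul_self (M := M) i) φ
      exact this.symm
    -- The Jucys–Murphy element of `i` is `s` plus the conjugate by `s` of that of `i + 1`.
    have hconj : ∀ q ∈ Ioi i.succ, youngRep M N (Equiv.swap i.castSucc q) φ w =
        youngOp M i (youngRep M N (Equiv.swap i.succ q) ψ) w := by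
      intro q hq
      rw [mem_Ioi, Fin.lt_def] at hq
      have hq1 : q ≠ i.castSucc := by rw [Ne, Fin.ext_iff]; simp at hq ⊢; omega
      have hq2 : q ≠ i.succ := by rw [Ne, Fin.ext_iff]; omega
      have e1 : Equiv.swap i.castSucc q = s * (Equiv.swap i.succ q * s) := by
        have : s * Equiv.swap i.succ q * s⁻¹ = Equiv.swap (s i.succ) (s q) :=
          (Equiv.swap_apply_apply s i.succ q).symm
        rw [hs, Equiv.swap_apply_right, Equiv.swap_apply_of_ne_of_ne hq1 hq2, Equiv.swap_inv,
          mul_assoc] at this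
        exact this.symm
      rw [e1, map_mul, map_mul, hs, youngRep_swap]
      rfl
    set χ := ∑ q ∈ Ioi i.succ, youngRep M N (Equiv.swap i.succ q) ψ with hχ
    have hχ' : ∀ v : Fin (N + 1) → ℤ, extend χ v = v i.succ * extend ψ v := by
      intro v
      by_cases hv : v ∈ tableaux (N + 1) M
      · have := ih ψ ⟨v, hv⟩
        rw [extend, dif_pos hv, extend, dif_pos hv, ← this, hχ, Finset.sum_apply]
      · rw [extend, dif_neg hv, extend, dif_neg hv, mul_zero]
    rw [e, sum_insert (by simp), sum_congr rfl hconj, ← Finset.sum_apply, ← map_sum, ← hχ,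
      youngRep_swap, ← hψ, youngOp_apply, formalOp, hχ', hχ']
    conv_rhs => rw [hφ, youngOp_apply, formalOp]
    have hne := ne_of_mem_words (mem_tableaux.1 w.2).1 i
    have z : (((w : Fin (N + 1) → ℤ) i.castSucc - (w : Fin (N + 1) → ℤ) i.succ : ℤ) : ℂ) ≠ 0 := by
      exact_mod_cast sub_ne_zero.2 hne
    rw [extend_coe, Function.comp_apply, Equiv.swap_apply_right]
    field_simp
    push_cast
    ring

/-! ### Connectedness of the set of words of a given shape -/

/-- `v` arises from the word `w` by an admissible adjacent transposition. -/
def AdmissibleSwap {N : ℕ} (w v : Fin (N + 1) → ℤ) : Prop :=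
  w ∈ words (N + 1) ∧ ∃ i : Fin N, w i.castSucc - w i.succ ≠ 1 ∧ w i.castSucc - w i.succ ≠ -1 ∧
    v = w ∘ Equiv.swap i.castSucc i.succ

theorem AdmissibleSwap.cons {N : ℕ} {w v : Fin (N + 1) → ℤ} (h : AdmissibleSwap w v) {c : ℤ}
    (hc : c ∈ addable (shape w)) :
    AdmissibleSwap (Fin.cons c w : Fin (N + 1 + 1) → ℤ) (Fin.cons c v) := by
  obtain ⟨hw, i, h1, h2, rfl⟩ := h
  refine ⟨cons_mem_words.2 ⟨hw, hc⟩, i.succ, h1, h2, ?_⟩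
  rw [← Fin.cons_self_tail ((Fin.cons c w : Fin (N + 1 + 1) → ℤ) ∘ _), ← Fin.succ_castSucc,
    tail_comp_swap_succ, Fin.tail_cons, Function.comp_apply, Equiv.swap_apply_of_ne_of_ne
    (Fin.succ_ne_zero _).symm (Fin.succ_ne_zero _).symm, Fin.cons_zero]

theorem mem_words_of_reflTransGen {N : ℕ} {w v : Fin (N + 1) → ℤ}
    (h : Relation.ReflTransGen AdmissibleSwap w v) (hw : w ∈ words (N + 1)) :
    v ∈ words (N + 1) ∧ shape v = shape w := by
  induction h with
  | refl => exact ⟨hw, rfl⟩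
  | tail _ hstep ih =>
    obtain ⟨h, i, h1, h2, rfl⟩ := hstep
    exact ⟨comp_swap_mem_words h i h1 h2, by rw [shape_comp_perm, ih.2]⟩

theorem reflTransGen_cons {N : ℕ} {w v : Fin (N + 1) → ℤ}
    (h : Relation.ReflTransGen AdmissibleSwap w v) {c : ℤ} (hw : w ∈ words (N + 1))
    (hc : c ∈ addable (shape w)) : Relation.ReflTransGen AdmissibleSwap
      (Fin.cons c w : Fin (N + 1 + 1) → ℤ) (Fin.cons c v) := by
  induction h with
  | refl => exact .refl
  | tail h hstep ih =>
    refine ih.tail (hstep.cons ?_)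
    rw [(mem_words_of_reflTransGen h hw).2]
    exact hc

/-- If `b ≠ w 0`, bring `b` to the front of the tail by induction; `w 0` and `b` are nonadjacent, so
a final swap is admissible. -/
theorem exists_reflTransGen_removable {N : ℕ} {w : Fin (N + 1) → ℤ} (hw : w ∈ words (N + 1))
    {b : ℤ} (hb : b ∈ removable (shape w)) :
    ∃ v, Relation.ReflTransGen AdmissibleSwap w v ∧ v 0 = b := by
  induction N with
  | zero =>
    refine ⟨w, .refl, ?_⟩
    have := mem_of_mem_removable (mem_image_of_mem _ hw) hb
    rw [shape_succ, show shape (Fin.tail w) = 0 from rfl] at this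
    simpa [eq_comm] using this
  | succ N ih =>
    by_cases h0 : b = w 0
    · exact ⟨w, .refl, h0.symm⟩
    obtain ⟨hw1, hw2⟩ := mem_words_succ.1 hw
    rw [shape_succ] at hb
    obtain ⟨h1, h2, h3⟩ := mem_removable_of_cons hw2 hb h0
    obtain ⟨v, hv, hvb⟩ := ih hw1 h1
    have hlift := reflTransGen_cons hv hw1 hw2
    rw [Fin.cons_self_tail] at hlift
    refine ⟨_, hlift.tail ⟨(mem_words_of_reflTransGen hlift hw).1, 0, ?_, ?_, rfl⟩, ?_⟩
    · change w 0 - v 0 ≠ 1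
      omega
    · change w 0 - v 0 ≠ -1
      omega
    · exact hvb

theorem reflTransGen_of_shape_eq {N : ℕ} {w v : Fin (N + 1) → ℤ} (hw : w ∈ words (N + 1))
    (hv : v ∈ words (N + 1)) (h : shape w = shape v) :
    Relation.ReflTransGen AdmissibleSwap w v := by
  induction N with
  | zero =>
    have h1 := last_of_mem_words hw
    have h2 := last_of_mem_words hv
    have : w = v := by
      funext i
      rw [show i = Fin.last 0 from Fin.ext (by have := i.2; simp), h1, h2]
    rw [this]
  | succ N ih =>
    obtain ⟨hv1, hv2⟩ := mem_words_succ.1 hv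
    have hb : v 0 ∈ removable (shape w) := by
      rw [h, shape_succ, removable_cons hv2]
      exact mem_insert_self _ _
    obtain ⟨u, hu, hu0⟩ := exists_reflTransGen_removable hw hb
    obtain ⟨hu1, hu2⟩ := mem_words_of_reflTransGen hu hw
    obtain ⟨hu3, hu4⟩ := mem_words_succ.1 hu1
    rw [h, shape_succ, shape_succ v, hu0, Multiset.cons_inj_right] at hu2
    rw [hu0] at hu4
    have := reflTransGen_cons (ih hu3 hv1 hu2) hu3 hu4
    rw [Fin.cons_self_tail, ← hu0, Fin.cons_self_tail] at this
    exact hu.trans this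

/-! ### Irreducibility -/

section

variable {N : ℕ} {M : Multiset ℤ}

theorem mul_mem_subrepresentation {U : Subrepresentation (youngRep M N)}
    {φ : tableaux (N + 1) M → ℂ} (hφ : φ ∈ U.toSubmodule) (p : Fin (N + 1)) :
    (fun w : tableaux (N + 1) M => ((w : Fin (N + 1) → ℤ) p : ℂ) * φ w) ∈ U.toSubmodule := by
  have h : ∑ q ∈ Ioi p, youngRep M N (Equiv.swap p q) φ ∈ U.toSubmodule :=
    Submodule.sum_mem _ fun q _ => U.apply_mem_toSubmodule _ hφ
  convert h using 1
  funext w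
  rw [Finset.sum_apply, sum_youngRep_swap]

/-- Distinct words differ at some `p`; subtracting the scalar `v p` from the Jucys–Murphy element of
`p` kills the coordinate `v` and keeps `w`. -/
theorem single_mem_subrepresentation {U : Subrepresentation (youngRep M N)}
    {φ : tableaux (N + 1) M → ℂ} (hφ : φ ∈ U.toSubmodule) {w : tableaux (N + 1) M}
    (hw : φ w ≠ 0) : Pi.single w 1 ∈ U.toSubmodule := by
  have key : ∀ s : Finset (tableaux (N + 1) M), w ∉ s →
      ∃ ψ ∈ U.toSubmodule, ψ w ≠ 0 ∧ ∀ v ∈ s, ψ v = 0 := by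
    intro s
    induction s using Finset.induction_on with
    | empty => exact fun _ => ⟨φ, hφ, hw, by simp⟩
    | insert v s _ ih =>
      intro hws
      rw [mem_insert, not_or] at hws
      obtain ⟨ψ, hψ, hψw, hψs⟩ := ih hws.2
      obtain ⟨p, hp⟩ : ∃ p, (w : Fin (N + 1) → ℤ) p ≠ (v : Fin (N + 1) → ℤ) p := by
        by_contra! h
        exact hws.1 (Subtype.ext (funext h))
      refine ⟨_, U.toSubmodule.sub_mem (mul_mem_subrepresentation hψ p)
        (U.toSubmodule.smul_mem ((v : Fin (N + 1) → ℤ) p : ℂ) hψ), ?_, ?_⟩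
      · simp only [Pi.sub_apply, Pi.smul_apply, smul_eq_mul, ← sub_mul]
        refine mul_ne_zero (sub_ne_zero.2 ?_) hψw
        exact_mod_cast hp
      · intro u hu
        simp only [Pi.sub_apply, Pi.smul_apply, smul_eq_mul, ← sub_mul]
        rcases mem_insert.1 hu with rfl | hu
        · simp
        · rw [hψs u hu, mul_zero]
  obtain ⟨ψ, hψ, hψw, hψ0⟩ := key (univ.erase w) (by simp)
  have e : Pi.single w 1 = (ψ w)⁻¹ • ψ := by
    funext v
    by_cases h : v = w
    · subst h; simp [hψw]
    · rw [Pi.single_eq_of_ne h, Pi.smul_apply, hψ0 v (by simp [h]), smul_zero]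
  rw [e]
  exact U.toSubmodule.smul_mem _ hψ

/-- A nonzero invariant subspace contains a basis vector, and admissible swaps, having nonzero
off-diagonal coefficient, spread it to all words of the shape. -/
theorem isIrreducible_youngRep (hM : M ∈ shapes (N + 1)) : (youngRep M N).IsIrreducible := by
  obtain ⟨w₀, hw₀, hw₀M⟩ := mem_image.1 hM
  have hne : Nonempty (tableaux (N + 1) M) := ⟨⟨w₀, mem_tableaux.2 ⟨hw₀, hw₀M⟩⟩⟩
  have : Nontrivial (Subrepresentation (youngRep M N)) :=
    ⟨⊥, ⊤, fun h => bot_ne_top (α := Submodule ℂ (tableaux (N + 1) M → ℂ))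
      (congrArg Subrepresentation.toSubmodule h)⟩
  refine ⟨fun U => ?_⟩
  by_cases hU : U.toSubmodule = ⊥
  · exact Or.inl (Subrepresentation.toSubmodule_injective hU)
  right
  apply Subrepresentation.toSubmodule_injective
  change U.toSubmodule = ⊤
  obtain ⟨φ, hφ, hφ0⟩ := Submodule.exists_mem_ne_zero_of_ne_bot hU
  obtain ⟨w, hw⟩ := Function.ne_iff.1 hφ0
  have hsingle := single_mem_subrepresentation hφ hw
  have hall : ∀ v : Fin (N + 1) → ℤ, Relation.ReflTransGen AdmissibleSwap (w : _) v →
      ∃ hv : v ∈ tableaux (N + 1) M, Pi.single ⟨v, hv⟩ 1 ∈ U.toSubmodule := by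
    intro v h
    induction h with
    | refl => exact ⟨w.2, hsingle⟩
    | @tail u v _ hstep ih =>
      obtain ⟨hu, ihu⟩ := ih
      obtain ⟨huw, i, h1, h2, rfl⟩ := hstep
      have hv := comp_swap_mem_tableaux hu i h1 h2
      refine ⟨hv, single_mem_subrepresentation (U.apply_mem_toSubmodule
        (Equiv.swap i.castSucc i.succ) ihu) ?_⟩
      have hne := ne_of_mem_words huw i
      have e : (u ∘ Equiv.swap i.castSucc i.succ) ∘ Equiv.swap i.castSucc i.succ = u := by
        funext k; simp
      have hvu : (⟨u ∘ Equiv.swap i.castSucc i.succ, hv⟩ : tableaux (N + 1) M) ≠ ⟨u, hu⟩ := by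
        intro h
        have := congrFun (congrArg Subtype.val h) i.castSucc
        simp at this
        exact hne this.symm
      rw [youngRep_swap, youngOp_apply, formalOp, extend_coe, Pi.single_eq_of_ne hvu, mul_zero,
        zero_add]
      simp only [e]
      rw [extend, dif_pos hu, Pi.single_eq_same, mul_one]
      simp only [Function.comp_apply, Equiv.swap_apply_left, Equiv.swap_apply_right]
      exact offCoeff_ne_zero (by omega) (by omega)
  rw [eq_top_iff]
  intro ψ _
  rw [← Finset.univ_sum_single ψ]
  refine Submodule.sum_mem _ fun v _ => ?_
  have e : Pi.single v (ψ v) = ψ v • (Pi.single v 1 : tableaux (N + 1) M → ℂ) := by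
    rw [← Pi.single_smul, smul_eq_mul, mul_one]
  rw [e]
  have hv := mem_tableaux.1 v.2
  have hw' := mem_tableaux.1 w.2
  obtain ⟨_, h⟩ := hall v (reflTransGen_of_shape_eq hw'.1 hv.1 (hw'.2.trans hv.2.symm))
  exact U.toSubmodule.smul_mem _ h

/-- An equivalence preserves joint Jucys–Murphy eigenvalues, and these form a word, which determines
the shape. -/
theorem eq_of_equiv_youngRep {M' : Multiset ℤ} (hM : M ∈ shapes (N + 1))
    (e : Representation.Equiv (youngRep M N) (youngRep M' N)) : M = M' := by
  by_contra hne
  obtain ⟨w, hw, hwM⟩ := mem_image.1 hM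
  set δ : tableaux (N + 1) M → ℂ := Pi.single ⟨w, mem_tableaux.2 ⟨hw, hwM⟩⟩ 1 with hδ
  have hδ0 : δ ≠ 0 := by
    rw [hδ, Ne, Pi.single_eq_zero_iff]
    exact one_ne_zero
  refine hδ0 (e.toLinearEquiv.injective ?_)
  rw [map_zero]
  funext v
  obtain ⟨p, hp⟩ : ∃ p, w p ≠ (v : Fin (N + 1) → ℤ) p := by
    by_contra! h
    have : w = v := funext h
    exact hne (by rw [← hwM, this, (mem_tableaux.1 v.2).2])
  have h1 := sum_youngRep_swap p (e.toLinearEquiv δ) v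
  have h2 : ∑ q ∈ Ioi p, youngRep M N (Equiv.swap p q) δ = (w p : ℂ) • δ := by
    funext u
    rw [Finset.sum_apply, sum_youngRep_swap, Pi.smul_apply, smul_eq_mul, hδ]
    by_cases hu : u = ⟨w, mem_tableaux.2 ⟨hw, hwM⟩⟩
    · rw [hu]
    · rw [Pi.single_eq_of_ne hu, mul_zero, mul_zero]
  have h3 : ∀ q, youngRep M' N (Equiv.swap p q) (e.toLinearEquiv δ) =
      e.toLinearEquiv (youngRep M N (Equiv.swap p q) δ) := fun q =>
    (Representation.IntertwiningMap.isIntertwining _ _ e.toIntertwiningMap _ _).symm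
  rw [← Finset.sum_apply, sum_congr rfl fun q _ => h3 q, ← map_sum, h2, map_smul, Pi.smul_apply,
    smul_eq_mul, mul_eq_mul_right_iff] at h1
  refine h1.resolve_left ?_
  exact_mod_cast hp

/-- The sum of all transpositions acts as the sum of the contents. -/
theorem sum_sum_youngRep_swap (φ : tableaux (N + 1) M → ℂ) :
    ∑ p, ∑ q ∈ Ioi p, youngRep M N (Equiv.swap p q) φ = (M.sum : ℂ) • φ := by
  funext w
  have h : M.sum = ∑ p, (w : Fin (N + 1) → ℤ) p := by
    rw [← sum_shape, (mem_tableaux.1 w.2).2]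
  rw [Finset.sum_apply, sum_congr rfl fun p _ => by rw [Finset.sum_apply, sum_youngRep_swap],
    ← sum_mul, Pi.smul_apply, smul_eq_mul, h, Int.cast_sum]

end

/-! ### Completeness of the characters of the symmetric group -/

section Completeness

variable {N : ℕ} {M : Multiset ℤ}

theorem star_formalOp {n : ℕ} (i j : Fin n) (Φ : (Fin n → ℤ) → ℂ) (w : Fin n → ℤ) :
    star (formalOp i j Φ w) = formalOp i j (star Φ) w := by
  have h1 : star (((w i - w j : ℤ) : ℂ)⁻¹) = ((w i - w j : ℤ) : ℂ)⁻¹ := by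
    rw [star_inv₀]
    congr 1
    exact map_intCast (starRingEnd ℂ) _
  have h2 : star (offCoeff (w i - w j)) = offCoeff (w i - w j) := Complex.conj_ofReal _
  simp only [formalOp, star_add, star_mul', h1, h2, Pi.star_apply]

theorem star_youngRep (g : Equiv.Perm (Fin (N + 1))) (φ : tableaux (N + 1) M → ℂ) :
    star (youngRep M N g φ) = youngRep M N g (star φ) := by
  have hg : g ∈ Submonoid.closure
      (Set.range fun i : Fin N => Equiv.swap i.castSucc i.succ) := by
    rw [Equiv.Perm.mclosure_swap_castSucc_succ]
    trivial
  induction hg using Submonoid.closure_induction generalizing φ with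
  | mem g hg =>
    obtain ⟨i, rfl⟩ := hg
    funext w
    rw [youngRep_swap, Pi.star_apply, youngOp_apply, youngOp_apply, star_formalOp]
    congr 1
    funext v
    by_cases hv : v ∈ tableaux (N + 1) M <;> simp [extend, hv]
  | one => simp
  | mul x y _ _ hx hy => rw [map_mul, Module.End.mul_apply, Module.End.mul_apply, hx, hy]

theorem star_character_youngRep (g : Equiv.Perm (Fin (N + 1))) :
    star ((youngRep M N).character g) = (youngRep M N).character g := by
  have h : (youngRep M N).character g =
      ∑ w : tableaux (N + 1) M, youngRep M N g (Pi.single w 1) w := by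
    rw [Representation.character,
      LinearMap.trace_eq_matrix_trace ℂ (Pi.basisFun ℂ (tableaux (N + 1) M))]
    simp [Matrix.trace]
  rw [h, star_sum]
  refine sum_congr rfl fun w _ => ?_
  rw [← Pi.star_apply, star_youngRep, ← Pi.single_star, star_one]

theorem character_inv {n : ℕ} {V : Type*} [AddCommGroup V] [Module ℂ V]
    (ρ : Representation ℂ (Equiv.Perm (Fin n)) V) (g : Equiv.Perm (Fin n)) :
    ρ.character g⁻¹ = ρ.character g := by
  have h : IsConj g g⁻¹ := by
    rw [Equiv.Perm.isConj_iff_cycleType_eq, Equiv.Perm.cycleType_inv]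
  obtain ⟨c, hc⟩ := isConj_iff.1 h
  rw [← hc, Representation.char_conj]

theorem sum_character_mul_character {M' : Multiset ℤ} (hM : M ∈ shapes (N + 1))
    (hM' : M' ∈ shapes (N + 1)) :
    ∑ g, (youngRep M N).character g * (youngRep M' N).character g =
      if M = M' then ((N + 1).factorial : ℂ) else 0 := by
  have hcard : (Nat.card (Equiv.Perm (Fin (N + 1))) : ℂ) = ((N + 1).factorial : ℂ) := by
    rw [Nat.card_perm, Nat.card_fin]
  have hc : (Nat.card (Equiv.Perm (Fin (N + 1))) : ℂ) ≠ 0 := Nat.cast_ne_zero.2 Nat.card_pos.ne'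
  let _ : Invertible (Nat.card (Equiv.Perm (Fin (N + 1))) : ℂ) := invertibleOfNonzero hc
  have := isIrreducible_youngRep hM
  have := isIrreducible_youngRep hM'
  have h := Representation.char_orthonormal (youngRep M N) (youngRep M' N)
  simp only [character_inv] at h
  rw [inv_mul_eq_iff_eq_mul₀ hc, hcard] at h
  rw [h]
  by_cases hMM : M = M'
  · subst hMM
    rw [if_pos ⟨Representation.Equiv.refl _⟩, if_pos rfl, mul_one]
  · rw [if_neg, if_neg hMM, mul_zero]
    rintro ⟨e⟩
    exact hMM (eq_of_equiv_youngRep hM' e).symm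

theorem character_youngRep_one : (youngRep M N).character 1 = numWords (N + 1) M := by
  rw [Representation.char_one, finrank_youngRep]

/-- The regular character is the sum of the irreducible characters, weighted by their degrees. -/
theorem sum_numWords_mul_character (N : ℕ) (g : Equiv.Perm (Fin (N + 1))) :
    ∑ M ∈ shapes (N + 1), (numWords (N + 1) M : ℂ) * (youngRep M N).character g =
      if g = 1 then ((N + 1).factorial : ℂ) else 0 := by
  set D : Equiv.Perm (Fin (N + 1)) → ℂ := fun g =>
    ∑ M ∈ shapes (N + 1), (numWords (N + 1) M : ℂ) * (youngRep M N).character g with hD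
  set F : ℂ := ((N + 1).factorial : ℂ) with hF
  have hsq : ∑ M ∈ shapes (N + 1), (numWords (N + 1) M : ℂ) * numWords (N + 1) M = F := by
    have := sum_numWords_sq (N + 1)
    simp only [sq] at this
    rw [hF, ← this]
    push_cast
    rfl
  have hD1 : D 1 = F := by
    rw [← hsq]
    exact sum_congr rfl fun M _ => by rw [character_youngRep_one]
  have hDD : ∑ g, D g * D g = F * F := by
    calc ∑ g, D g * D g = ∑ M ∈ shapes (N + 1), ∑ M' ∈ shapes (N + 1),
          (numWords (N + 1) M : ℂ) * numWords (N + 1) M' *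
            ∑ g, (youngRep M N).character g * (youngRep M' N).character g := by
          simp only [hD, sum_mul_sum]
          rw [sum_comm]
          refine sum_congr rfl fun M _ => ?_
          rw [sum_comm]
          refine sum_congr rfl fun M' _ => ?_
          rw [mul_sum]
          exact sum_congr rfl fun g _ => by ring
      _ = ∑ M ∈ shapes (N + 1), (numWords (N + 1) M : ℂ) * numWords (N + 1) M * F := by
          refine sum_congr rfl fun M hM => ?_
          rw [sum_congr rfl fun M' hM' => by rw [sum_character_mul_character hM hM', mul_ite,
            mul_zero], sum_ite_eq, if_pos hM]
      _ = F * F := by rw [← sum_mul, hsq]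
  -- The squares of `D` sum to `D 1 * D 1`; as `D` is real, all other values must vanish.
  have hreal : ∀ g, (starRingEnd ℂ) (D g) = D g := by
    intro g
    rw [hD, map_sum]
    refine sum_congr rfl fun M _ => ?_
    rw [map_mul, Complex.conj_natCast]
    congr 1
    exact star_character_youngRep g
  have hre : ∀ g, ((D g).re : ℂ) = D g := fun g => Complex.conj_eq_iff_re.1 (hreal g)
  have hF' : F = ((((N + 1).factorial : ℕ) : ℝ) : ℂ) := by rw [hF]; push_cast; rfl
  have hsum : ∑ g, (D g).re ^ 2 = (((N + 1).factorial : ℕ) : ℝ) ^ 2 := by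
    have : ((∑ g, (D g).re ^ 2 : ℝ) : ℂ) = (((((N + 1).factorial : ℕ) : ℝ) ^ 2 : ℝ) : ℂ) := by
      push_cast
      rw [sq, ← hF, ← hDD]
      exact sum_congr rfl fun g _ => by rw [hre, sq]
    exact_mod_cast this
  split_ifs with hg
  · rw [hg]; exact hD1
  · have h1 : (D 1).re = (((N + 1).factorial : ℕ) : ℝ) := by rw [hD1, hF', Complex.ofReal_re]
    rw [← add_sum_erase _ _ (mem_univ (1 : Equiv.Perm (Fin (N + 1)))), h1, add_eq_left,
      sum_eq_zero_iff_of_nonneg fun _ _ => sq_nonneg _] at hsum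
    have := hsum g (by simp [hg])
    change D g = 0
    rw [← hre, pow_eq_zero_iff two_ne_zero |>.1 this, Complex.ofReal_zero]

end Completeness

/-! ### Restriction to the alternating group -/

section Alternating

variable {n : ℕ} {V : Type*} [AddCommGroup V] [Module ℂ V]

def altRes (ρ : Representation ℂ (Equiv.Perm (Fin n)) V) :
    Representation ℂ (alternatingGroup (Fin n)) V := ρ.comp (alternatingGroup (Fin n)).subtype

/-- A proper nonzero subrepresentation of the restriction of an irreducible representation is
complementary to its translate by an odd permutation. -/
theorem isCompl_map_of_altRes (ρ : Representation ℂ (Equiv.Perm (Fin n)) V)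
    (hρ : ρ.IsIrreducible) (I : Subrepresentation (altRes ρ)) (h0 : I.toSubmodule ≠ ⊥)
    (h1 : I.toSubmodule ≠ ⊤) {τ : Equiv.Perm (Fin n)} (hτ : Equiv.Perm.sign τ = -1)
    (hττ : τ * τ = 1) : IsCompl I.toSubmodule (I.toSubmodule.map (ρ τ)) := by
  have hA : ∀ g : Equiv.Perm (Fin n), Equiv.Perm.sign g = 1 → ∀ v ∈ I.toSubmodule,
      ρ g v ∈ I.toSubmodule := fun g hg v hv => I.apply_mem_toSubmodule ⟨g, hg⟩ hv
  have happ : ∀ v, ρ τ (ρ τ v) = v := fun v => by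
    rw [← Module.End.mul_apply, ← map_mul, hττ, map_one, Module.End.one_apply]
  have hodd : ∀ g : Equiv.Perm (Fin n), Equiv.Perm.sign g = -1 → ∀ v ∈ I.toSubmodule,
      ρ g v ∈ I.toSubmodule.map (ρ τ) := by
    intro g hg v hv
    refine ⟨ρ (τ * g) v, hA _ (by rw [Equiv.Perm.sign_mul, hτ, hg]; rfl) v hv, ?_⟩
    rw [map_mul, Module.End.mul_apply, happ]
  have hA' : ∀ g : Equiv.Perm (Fin n), Equiv.Perm.sign g = 1 →
      ∀ v ∈ I.toSubmodule.map (ρ τ), ρ g v ∈ I.toSubmodule.map (ρ τ) := by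
    rintro g hg _ ⟨v, hv, rfl⟩
    rw [← Module.End.mul_apply, ← map_mul]
    exact hodd _ (by rw [Equiv.Perm.sign_mul, hτ, hg]; rfl) v hv
  have hodd' : ∀ g : Equiv.Perm (Fin n), Equiv.Perm.sign g = -1 →
      ∀ v ∈ I.toSubmodule.map (ρ τ), ρ g v ∈ I.toSubmodule := by
    rintro g hg _ ⟨v, hv, rfl⟩
    rw [← Module.End.mul_apply, ← map_mul]
    exact hA _ (by rw [Equiv.Perm.sign_mul, hτ, hg]; rfl) v hv
  -- Even permutations preserve `I` and its translate and odd ones exchange them, so intersection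
  -- and sum are invariant under the whole group.
  let P : Subrepresentation ρ := ⟨I.toSubmodule ⊓ I.toSubmodule.map (ρ τ), fun g v hv => by
    rcases Int.units_eq_one_or (Equiv.Perm.sign g) with hg | hg
    · exact ⟨hA g hg v hv.1, hA' g hg v hv.2⟩
    · exact ⟨hodd' g hg v hv.2, hodd g hg v hv.1⟩⟩
  let Q : Subrepresentation ρ := ⟨I.toSubmodule ⊔ I.toSubmodule.map (ρ τ), fun g v hv => by
    obtain ⟨x, hx, y, hy, rfl⟩ := Submodule.mem_sup.1 hv
    rw [map_add]
    rcases Int.units_eq_one_or (Equiv.Perm.sign g) with hg | hg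
    · exact Submodule.add_mem_sup (hA g hg x hx) (hA' g hg y hy)
    · rw [add_comm]
      exact Submodule.add_mem_sup (hodd' g hg y hy) (hodd g hg x hx)⟩
  constructor
  · rw [disjoint_iff]
    rcases hρ.eq_bot_or_eq_top P with h | h
    · exact congrArg Subrepresentation.toSubmodule h
    · exact absurd (eq_top_iff.2 ((congrArg Subrepresentation.toSubmodule h).symm.le.trans
        inf_le_left)) h1
  · rw [codisjoint_iff]
    rcases hρ.eq_bot_or_eq_top Q with h | h
    · exact absurd (eq_bot_iff.2 (le_sup_left.trans
        (congrArg Subrepresentation.toSubmodule h).le)) h0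
    · exact congrArg Subrepresentation.toSubmodule h

theorem two_mul_finrank_of_altRes [FiniteDimensional ℂ V] (ρ : Representation ℂ (Equiv.Perm (Fin n)) V)
    (hρ : ρ.IsIrreducible) (hn : 2 ≤ n) (I : Subrepresentation (altRes ρ))
    (h0 : I.toSubmodule ≠ ⊥) (h1 : I.toSubmodule ≠ ⊤) :
    2 * Module.finrank ℂ I.toSubmodule = Module.finrank ℂ V := by
  set τ : Equiv.Perm (Fin n) := Equiv.swap ⟨0, by omega⟩ ⟨1, by omega⟩ with hτ
  have hττ : τ * τ = 1 := Equiv.swap_mul_self _ _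
  have hs : Equiv.Perm.sign τ = -1 := Equiv.Perm.sign_swap (by simp)
  have hc := isCompl_map_of_altRes ρ hρ I h0 h1 hs hττ
  have hinj : Function.Injective (ρ τ) := by
    refine Function.LeftInverse.injective (g := ρ τ) fun v => ?_
    rw [← Module.End.mul_apply, ← map_mul, hττ, map_one, Module.End.one_apply]
  rw [← Submodule.finrank_add_eq_of_isCompl hc,
    ← (Submodule.equivMapOfInjective (ρ τ) hinj I.toSubmodule).finrank_eq]
  ring

/-- Every transposition carries `I` into its complementary translate, while their sum acts as a
scalar and preserves `I`. -/
theorem eq_zero_of_altRes (ρ : Representation ℂ (Equiv.Perm (Fin n)) V)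
    (hρ : ρ.IsIrreducible) (hn : 2 ≤ n) (I : Subrepresentation (altRes ρ))
    (h0 : I.toSubmodule ≠ ⊥) (h1 : I.toSubmodule ≠ ⊤) {c : ℂ}
    (hc : ∀ v, ∑ p, ∑ q ∈ Ioi p, ρ (Equiv.swap p q) v = c • v) : c = 0 := by
  set τ : Equiv.Perm (Fin n) := Equiv.swap ⟨0, by omega⟩ ⟨1, by omega⟩ with hτ
  have hττ : τ * τ = 1 := Equiv.swap_mul_self _ _
  have hs : Equiv.Perm.sign τ = -1 := Equiv.Perm.sign_swap (by simp)
  have hcompl := isCompl_map_of_altRes ρ hρ I h0 h1 hs hττ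
  obtain ⟨v, hv, hv0⟩ := Submodule.exists_mem_ne_zero_of_ne_bot h0
  have hmem : c • v ∈ I.toSubmodule.map (ρ τ) := by
    rw [← hc]
    refine Submodule.sum_mem _ fun p _ => Submodule.sum_mem _ fun q hq => ?_
    have hpq : p ≠ q := (mem_Ioi.1 hq).ne
    refine ⟨ρ (τ * Equiv.swap p q) v, I.apply_mem_toSubmodule ⟨τ * Equiv.swap p q, ?_⟩ hv, ?_⟩
    · rw [Equiv.Perm.mem_alternatingGroup, Equiv.Perm.sign_mul, hs, Equiv.Perm.sign_swap hpq]
      rfl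
    · rw [← Module.End.mul_apply, ← map_mul, ← mul_assoc, hττ, one_mul]
  have := Submodule.disjoint_def.1 hcompl.disjoint _ (I.toSubmodule.smul_mem c hv) hmem
  exact (smul_eq_zero.1 this).resolve_right hv0

end Alternating

/-! ### Degrees and multiplicities of the constituents -/

section Constituents

variable {n : ℕ} {V : Type*} [AddCommGroup V] [Module ℂ V]

theorem nontrivial_of_isIrreducible {G : Type*} [Group G] {ρ : Representation ℂ G V}
    (hρ : ρ.IsIrreducible) : Nontrivial V := by
  by_contra h
  rw [not_nontrivial_iff_subsingleton] at h
  obtain ⟨P, Q, hPQ⟩ := hρ.exists_pair_ne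
  exact hPQ (Subrepresentation.toSubmodule_injective (Subsingleton.elim _ _))

theorem nontrivial_subrepresentation {G : Type*} [Group G] [Nontrivial V]
    (ρ : Representation ℂ G V) : Nontrivial (Subrepresentation ρ) :=
  ⟨⊥, ⊤, fun h => bot_ne_top (α := Submodule ℂ V) (congrArg Subrepresentation.toSubmodule h)⟩

theorem isIrreducible_iff_forall {G : Type*} [Group G] [Nontrivial V]
    (ρ : Representation ℂ G V) :
    ρ.IsIrreducible ↔ ∀ I : Subrepresentation ρ, I.toSubmodule = ⊥ ∨ I.toSubmodule = ⊤ := by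
  constructor
  · intro h I
    exact (h.eq_bot_or_eq_top I).imp (congrArg Subrepresentation.toSubmodule)
      (congrArg Subrepresentation.toSubmodule)
  · intro h
    have := nontrivial_subrepresentation ρ
    exact ⟨fun I => (h I).imp (fun h => Subrepresentation.toSubmodule_injective h)
      (fun h => Subrepresentation.toSubmodule_injective h)⟩

theorem exists_proper_of_not_isIrreducible {G : Type*} [Group G] [Nontrivial V]
    {ρ : Representation ℂ G V} (h : ¬ ρ.IsIrreducible) :
    ∃ I : Subrepresentation ρ, I.toSubmodule ≠ ⊥ ∧ I.toSubmodule ≠ ⊤ := by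
  rw [isIrreducible_iff_forall] at h
  push Not at h
  exact h

variable [FiniteDimensional ℂ V]

open scoped Classical in
/-- The common degree of the irreducible constituents of the restriction of an irreducible
representation to the alternating group. -/
noncomputable def altDegree (ρ : Representation ℂ (Equiv.Perm (Fin n)) V) : ℕ :=
  if (altRes ρ).IsIrreducible then Module.finrank ℂ V else Module.finrank ℂ V / 2

variable {ρ : Representation ℂ (Equiv.Perm (Fin n)) V} (hρ : ρ.IsIrreducible) (hn : 2 ≤ n)

include hρ hn in
-- A nonzero invariant subspace of `I` also has half the dimension of `V`, hence is `I`.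
theorem isIrreducible_toRepresentation_of_altRes (I : Subrepresentation (altRes ρ))
    (h0 : I.toSubmodule ≠ ⊥) (h1 : I.toSubmodule ≠ ⊤) : I.toRepresentation.IsIrreducible := by
  have : Nontrivial I.toSubmodule := Submodule.nontrivial_iff_ne_bot.2 h0
  rw [isIrreducible_iff_forall]
  intro U
  by_contra! hU
  let J : Subrepresentation (altRes ρ) := ⟨U.toSubmodule.map I.toSubmodule.subtype, by
    rintro g _ ⟨v, hv, rfl⟩
    exact ⟨_, U.apply_mem_toSubmodule g hv, rfl⟩⟩
  have hJI : J.toSubmodule ≤ I.toSubmodule := Submodule.map_subtype_le _ _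
  have hJ0 : J.toSubmodule ≠ ⊥ := by
    intro h
    exact hU.1 (Submodule.map_injective_of_injective I.toSubmodule.injective_subtype
      (h.trans (Submodule.map_bot _).symm))
  have hJ1 : J.toSubmodule ≠ ⊤ := fun h => h1 (eq_top_iff.2 (h ▸ hJI))
  have e1 := two_mul_finrank_of_altRes ρ hρ hn I h0 h1
  have e2 := two_mul_finrank_of_altRes ρ hρ hn J hJ0 hJ1
  have e3 : J.toSubmodule = I.toSubmodule := Submodule.eq_of_le_of_finrank_eq hJI (by omega)
  refine hU.2 ?_
  have e4 : Module.finrank ℂ U.toSubmodule = Module.finrank ℂ J.toSubmodule :=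
    (Submodule.equivMapOfInjective _ I.toSubmodule.injective_subtype U.toSubmodule).finrank_eq
  exact Submodule.eq_top_of_finrank_eq (by rw [e4, e3])

include hρ hn in
-- `T` is injective by Schur. Its image is proper, of half dimension, or everything; in the latter
-- case the restriction is irreducible, as a proper invariant subspace would pull back to `θ`.
theorem finrank_eq_altDegree {U : Type*} [AddCommGroup U] [Module ℂ U] [FiniteDimensional ℂ U]
    {θ : Representation ℂ (alternatingGroup (Fin n)) U} (hθ : θ.IsIrreducible)
    {T : Representation.IntertwiningMap θ (altRes ρ)} (hT : T ≠ 0) :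
    Module.finrank ℂ U = altDegree ρ := by
  have hV := nontrivial_of_isIrreducible hρ
  have hU := nontrivial_of_isIrreducible hθ
  have hinj : Function.Injective T :=
    (Representation.IsIrreducible.injective_or_eq_zero T).resolve_right hT
  let I : Subrepresentation (altRes ρ) := ⟨LinearMap.range T.toLinearMap, by
    rintro g _ ⟨v, rfl⟩
    exact ⟨θ g v, T.isIntertwining _ _ _ _⟩⟩
  have hIdim : Module.finrank ℂ I.toSubmodule = Module.finrank ℂ U :=
    LinearMap.finrank_range_of_inj (f := T.toLinearMap) hinj
  have hUpos : 0 < Module.finrank ℂ U := Module.finrank_pos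
  have hI0 : I.toSubmodule ≠ ⊥ := by
    intro h
    rw [h, finrank_bot] at hIdim
    omega
  rw [altDegree]
  split_ifs with h
  · rcases (isIrreducible_iff_forall _).1 h I with h' | h'
    · exact absurd h' hI0
    · rw [← hIdim, h', finrank_top]
  · obtain ⟨J, hJ0, hJ1⟩ := exists_proper_of_not_isIrreducible h
    by_cases hI1 : I.toSubmodule = ⊤
    · exfalso
      let K : Subrepresentation θ := ⟨J.toSubmodule.comap T.toLinearMap, fun g v hv => by
        have := J.apply_mem_toSubmodule g hv
        rw [Submodule.mem_comap]
        convert this using 1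
        exact T.isIntertwining _ _ _ _⟩
      have hsurj : ∀ v, ∃ u, T.toLinearMap u = v := fun v => by
        have : v ∈ I.toSubmodule := by rw [hI1]; trivial
        exact this
      rcases (isIrreducible_iff_forall _).1 hθ K with h' | h'
      · obtain ⟨v, hv, hv0⟩ := Submodule.exists_mem_ne_zero_of_ne_bot hJ0
        obtain ⟨u, rfl⟩ := hsurj v
        have : u ∈ K.toSubmodule := hv
        rw [h', Submodule.mem_bot] at this
        rw [this, map_zero] at hv0
        exact hv0 rfl
      · refine hJ1 (eq_top_iff.2 fun v _ => ?_)
        obtain ⟨u, rfl⟩ := hsurj v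
        have : u ∈ K.toSubmodule := by rw [h']; trivial
        exact this
    · have := two_mul_finrank_of_altRes ρ hρ hn I hI0 hI1
      omega

include hρ hn in
theorem finrank_eq_altDegree_or {c : ℂ}
    (hc : ∀ v, ∑ p, ∑ q ∈ Ioi p, ρ (Equiv.swap p q) v = c • v) :
    Module.finrank ℂ V = altDegree ρ ∨ Module.finrank ℂ V = 2 * altDegree ρ ∧ c = 0 := by
  have hV := nontrivial_of_isIrreducible hρ
  rw [altDegree]
  split_ifs with h
  · exact Or.inl rfl
  · obtain ⟨J, hJ0, hJ1⟩ := exists_proper_of_not_isIrreducible h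
    have := two_mul_finrank_of_altRes ρ hρ hn J hJ0 hJ1
    exact Or.inr ⟨by omega, eq_zero_of_altRes ρ hρ hn J hJ0 hJ1 hc⟩

end Constituents

theorem exists_constituent {n : ℕ} (hn : 2 ≤ n) {V : Type} [AddCommGroup V] [Module ℂ V]
    [FiniteDimensional ℂ V] {ρ : Representation ℂ (Equiv.Perm (Fin n)) V}
    (hρ : ρ.IsIrreducible) :
    ∃ (U : Type) (_ : AddCommGroup U) (_ : Module ℂ U) (_ : FiniteDimensional ℂ U)
      (θ : Representation ℂ (alternatingGroup (Fin n)) U) (T : θ.IntertwiningMap (altRes ρ)),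
      θ.IsIrreducible ∧ T ≠ 0 := by
  have hV := nontrivial_of_isIrreducible hρ
  by_cases h : (altRes ρ).IsIrreducible
  · refine ⟨V, inferInstance, inferInstance, inferInstance, altRes ρ,
      Representation.IntertwiningMap.id _, h, fun h0 => ?_⟩
    obtain ⟨v, hv⟩ := exists_ne (0 : V)
    exact hv (congrArg (fun T : (altRes ρ).IntertwiningMap (altRes ρ) => T v) h0)
  · obtain ⟨J, hJ0, hJ1⟩ := exists_proper_of_not_isIrreducible h
    refine ⟨J.toSubmodule, inferInstance, inferInstance, inferInstance, J.toRepresentation,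
      ⟨J.toSubmodule.subtype, fun g => rfl⟩,
      isIrreducible_toRepresentation_of_altRes hρ hn J hJ0 hJ1, fun h0 => ?_⟩
    obtain ⟨v, hv, hv0⟩ := Submodule.exists_mem_ne_zero_of_ne_bot hJ0
    exact hv0 (congrArg (fun T : J.toRepresentation.IntertwiningMap (altRes ρ) => T ⟨v, hv⟩) h0)

/-- The inner product of a function on the alternating group with a character of the symmetric
group. -/
noncomputable def altInner (N : ℕ) (M : Multiset ℤ)
    (χ : alternatingGroup (Fin (N + 1)) → ℂ) : ℂ :=
  (Nat.card (alternatingGroup (Fin (N + 1))) : ℂ)⁻¹ *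
    ∑ a : alternatingGroup (Fin (N + 1)), (youngRep M N).character a * χ a⁻¹

theorem altInner_character (N : ℕ) (M : Multiset ℤ) {U : Type*} [AddCommGroup U] [Module ℂ U]
    [FiniteDimensional ℂ U] (θ : Representation ℂ (alternatingGroup (Fin (N + 1))) U) :
    altInner N M θ.character =
      Module.finrank ℂ (θ.IntertwiningMap (altRes (youngRep M N))) := by
  have hc : (Nat.card (alternatingGroup (Fin (N + 1))) : ℂ) ≠ 0 :=
    Nat.cast_ne_zero.2 Nat.card_pos.ne'
  let _ : Invertible (Nat.card (alternatingGroup (Fin (N + 1))) : ℂ) := invertibleOfNonzero hc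
  exact Representation.card_inv_mul_sum_char_mul_char_eq_finrank θ (altRes (youngRep M N))

/-- The regular character of the symmetric group restricts to twice that of the alternating group;
pair it with `θ`. -/
theorem sum_numWords_mul_finrank {N : ℕ} (hN : 1 ≤ N) {U : Type*} [AddCommGroup U] [Module ℂ U]
    [FiniteDimensional ℂ U] (θ : Representation ℂ (alternatingGroup (Fin (N + 1))) U) :
    ∑ M ∈ shapes (N + 1), numWords (N + 1) M *
      Module.finrank ℂ (θ.IntertwiningMap (altRes (youngRep M N))) =
        2 * Module.finrank ℂ U := by
  have : Nontrivial (Fin (N + 1)) := Fin.nontrivial_iff_two_le.2 (by omega)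
  set c : ℂ := (Nat.card (alternatingGroup (Fin (N + 1))) : ℂ) with hc
  have hc0 : c ≠ 0 := Nat.cast_ne_zero.2 Nat.card_pos.ne'
  have hcard : 2 * c = ((N + 1).factorial : ℂ) := by
    have := two_mul_nat_card_alternatingGroup (α := Fin (N + 1))
    rw [Nat.card_perm, Nat.card_fin] at this
    rw [hc]
    exact_mod_cast this
  have key : ∑ M ∈ shapes (N + 1), (numWords (N + 1) M : ℂ) * altInner N M θ.character =
      2 * Module.finrank ℂ U := by
    calc ∑ M ∈ shapes (N + 1), (numWords (N + 1) M : ℂ) * altInner N M θ.character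
        = c⁻¹ * ∑ a : alternatingGroup (Fin (N + 1)), (∑ M ∈ shapes (N + 1),
            (numWords (N + 1) M : ℂ) * (youngRep M N).character a) * θ.character a⁻¹ := by
          simp only [altInner, ← hc, mul_sum, sum_mul]
          rw [sum_comm]
          exact sum_congr rfl fun a _ => sum_congr rfl fun M _ => by ring
      _ = c⁻¹ * ((N + 1).factorial * θ.character 1) := by
          congr 1
          rw [sum_eq_single 1]
          · rw [sum_numWords_mul_character, if_pos (by simp), inv_one]
          · intro a _ ha
            rw [sum_numWords_mul_character, if_neg (by simpa using ha), zero_mul]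
          · simp
      _ = _ := by
          rw [← hcard, Representation.char_one]
          field_simp
  simp only [altInner_character] at key
  exact_mod_cast key

/-- Degree 3 leaves a constituent of degree at least 2 even after halving. -/
theorem exists_three_le_numWords {n : ℕ} (hn : 4 ≤ n) :
    ∃ M ∈ shapes n, 3 ≤ numWords n M := by
  induction n, hn using Nat.le_induction with
  | base =>
    -- The partition (3, 1).
    refine ⟨{0, 1, 2, -1}, ?_, by decide⟩
    decide
  | succ n _ ih =>
    obtain ⟨M, hM, h⟩ := ih
    obtain ⟨a, ha⟩ : (addable M).Nonempty := by
      rw [← card_pos, card_addable hM]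
      omega
    have haM := cons_mem_shapes hM ha
    refine ⟨_, haM, h.trans ?_⟩
    have hmem : a ∈ removable (a ::ₘ M) := by
      rw [removable_cons ha]
      exact mem_insert_self _ _
    rw [numWords_succ haM]
    refine le_trans ?_ (single_le_sum (f := fun b => numWords n ((a ::ₘ M).erase b))
      (fun _ _ => Nat.zero_le _) hmem)
    simp

section AltDegree

variable {N : ℕ} {M : Multiset ℤ}

theorem numWords_eq_altDegree (hN : 1 ≤ N) (hM : M ∈ shapes (N + 1)) :
    numWords (N + 1) M = altDegree (youngRep M N) ∨
      numWords (N + 1) M = 2 * altDegree (youngRep M N) ∧ M.sum = 0 := by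
  have := finrank_eq_altDegree_or (isIrreducible_youngRep hM) (by omega) sum_sum_youngRep_swap
  rw [finrank_youngRep] at this
  exact this.imp_right fun h => ⟨h.1, by exact_mod_cast h.2⟩

/-- Every irreducible constituent of the restriction of `youngRep M N` to the alternating group
is an irreducible character of degree `altDegree (youngRep M N)`. -/
theorem exists_irr_constituent (hN : 1 ≤ N) (hM : M ∈ shapes (N + 1)) :
    ∃ χ ∈ Irr (alternatingGroup (Fin (N + 1))), ‖χ 1‖ = altDegree (youngRep M N) ∧
      altDegree (youngRep M N) ∈ irrDegrees (alternatingGroup (Fin (N + 1))) ∧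
        altInner N M χ ≠ 0 := by
  have hρ := isIrreducible_youngRep hM
  obtain ⟨U, i1, i2, i3, θ, T, hθ, hT⟩ := exists_constituent (by omega) hρ
  have hdim := finrank_eq_altDegree hρ (by omega) hθ hT
  refine ⟨θ.character, ⟨U, i1, i2, i3, θ, hθ, rfl⟩, by simp [Representation.char_one, hdim],
    ⟨U, i1, i2, i3, θ, hθ, hdim⟩, ?_⟩
  rw [altInner_character, Nat.cast_ne_zero]
  intro h0
  rw [Module.finrank_eq_zero_iff_of_free ℂ] at h0
  exact hT (Subsingleton.elim _ _)

/-- An irreducible character of the alternating group is a constituent of the restriction of at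
most two irreducible characters of the symmetric group. -/
theorem card_filter_altInner_le_two (hN : 1 ≤ N) {χ : alternatingGroup (Fin (N + 1)) → ℂ}
    (hχ : χ ∈ Irr (alternatingGroup (Fin (N + 1)))) (s : Finset (Multiset ℤ))
    (hs : s ⊆ shapes (N + 1)) (h : ∀ M ∈ s, altInner N M χ ≠ 0) : s.card ≤ 2 := by
  obtain ⟨U, i1, i2, i3, θ, hθ, rfl⟩ := hχ
  have hU := nontrivial_of_isIrreducible hθ
  have hpos : 0 < Module.finrank ℂ U := Module.finrank_pos
  have hsum := sum_numWords_mul_finrank hN θ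
  refine Nat.le_of_mul_le_mul_right ?_ hpos
  rw [← hsum, ← smul_eq_mul, ← sum_const]
  refine (sum_le_sum fun M hM => ?_).trans (sum_le_sum_of_subset hs)
  have hM0 := h M hM
  rw [altInner_character, Nat.cast_ne_zero] at hM0
  have : Nontrivial (θ.IntertwiningMap (altRes (youngRep M N))) :=
    Module.nontrivial_of_finrank_pos (Nat.pos_of_ne_zero hM0)
  obtain ⟨T, hT⟩ := exists_ne (0 : θ.IntertwiningMap (altRes (youngRep M N)))
  have e := finrank_eq_altDegree (isIrreducible_youngRep (hs hM)) (by omega) hθ hT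
  have h1 : Module.finrank ℂ U ≤ numWords (N + 1) M := by
    rcases numWords_eq_altDegree hN (hs hM) with h | h <;> omega
  exact h1.trans (Nat.le_mul_of_pos_right _ (Nat.pos_of_ne_zero hM0))

theorem exists_altDegree_eq (hN : 1 ≤ N) {d : ℕ}
    (hd : d ∈ irrDegrees (alternatingGroup (Fin (N + 1)))) :
    ∃ M ∈ shapes (N + 1), altDegree (youngRep M N) = d := by
  obtain ⟨U, i1, i2, i3, θ, hθ, rfl⟩ := hd
  have hU := nontrivial_of_isIrreducible hθ
  have hpos : 0 < Module.finrank ℂ U := Module.finrank_pos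
  have hsum := sum_numWords_mul_finrank hN θ
  obtain ⟨M, hM, hM0⟩ := exists_ne_zero_of_sum_ne_zero (s := shapes (N + 1)) (by rw [hsum]; omega)
  have : Nontrivial (θ.IntertwiningMap (altRes (youngRep M N))) :=
    Module.nontrivial_of_finrank_pos (Nat.pos_of_ne_zero (right_ne_zero_of_mul hM0))
  obtain ⟨T, hT⟩ := exists_ne (0 : θ.IntertwiningMap (altRes (youngRep M N)))
  exact ⟨M, hM, (finrank_eq_altDegree (isIrreducible_youngRep hM) (by omega) hθ hT).symm⟩

end AltDegree

/-! ### The bound for large and for small degree -/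

theorem maxIrrDegree_pos (G : Type*) [Group G] [Finite G] : 0 < maxIrrDegree G := by
  obtain ⟨U, i1, i2, i3, θ, hθ, h⟩ := (isGreatest_maxIrrDegree G).1
  have hU := nontrivial_of_isIrreducible hθ
  rw [← h]
  exact Module.finrank_pos

theorem le_epsilonRatio {n : ℕ} (hn : 2000000 ≤ n) :
    1 / (8 * 10000 ^ 2) ≤ epsilonRatio (alternatingGroup (Fin n)) := by
  have hN' : 1 ≤ n - 1 := by omega
  obtain ⟨N, rfl⟩ : ∃ m, n = m + 1 := ⟨n - 1, by omega⟩
  have hN : 1 ≤ N := hN'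
  set A := alternatingGroup (Fin (N + 1)) with hA
  set b := maxIrrDegree A with hb
  have hb0 : 0 < b := maxIrrDegree_pos A
  have hbR : (0 : ℝ) < b := by exact_mod_cast hb0
  set d : Multiset ℤ → ℕ := fun M => altDegree (youngRep M N) with hd
  set B := (shapes (N + 1)).filter fun M => d M = b with hB
  have hBne : B.Nonempty := by
    obtain ⟨M, hM, h⟩ := exists_altDegree_eq hN (isGreatest_maxIrrDegree A).1
    exact ⟨M, mem_filter.2 ⟨hM, h⟩⟩
  have hmain := le_sum_sq_numWords_sdiff hn hBne (filter_subset _ _) hbR (fun M hM => by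
    obtain ⟨h1, h2⟩ := mem_filter.1 hM
    rw [← h2]
    refine (numWords_eq_altDegree hN h1).imp (fun h => ?_) (fun h => ⟨?_, h.2⟩)
    · exact_mod_cast h
    · exact_mod_cast h.1)
  clear hn hN'
  choose! χ hχ using fun M (hM : M ∈ shapes (N + 1)) => exists_irr_constituent hN hM
  set S := (Irr_finite A).toFinset.filter fun χ => ‖χ 1‖ < (b : ℝ) with hS
  have hmaps : ∀ M ∈ shapes (N + 1) \ B, χ M ∈ S := by
    intro M hM
    obtain ⟨h1, h2⟩ := mem_sdiff.1 hM
    obtain ⟨q1, q2, q3, -⟩ := hχ M h1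
    refine mem_filter.2 ⟨(Set.Finite.mem_toFinset _).2 q1, ?_⟩
    rw [q2]
    have h3 : d M ≤ b := (isGreatest_maxIrrDegree A).2 q3
    have h4 : d M ≠ b := fun h => h2 (mem_filter.2 ⟨h1, h⟩)
    exact_mod_cast lt_of_le_of_ne h3 h4
  -- The factor 8 is 4, from squaring `numWords ≤ 2 * altDegree`, times the at most two shapes
  -- sharing a character.
  have hle : ∑ M ∈ shapes (N + 1) \ B, (numWords (N + 1) M : ℝ) ^ 2 ≤
      8 * ∑ χ ∈ S, ‖χ 1‖ ^ 2 := by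
    calc ∑ M ∈ shapes (N + 1) \ B, (numWords (N + 1) M : ℝ) ^ 2
        ≤ ∑ M ∈ shapes (N + 1) \ B, 4 * ‖χ M 1‖ ^ 2 := by
          refine sum_le_sum fun M hM => ?_
          have hM' := (mem_sdiff.1 hM).1
          rw [(hχ M hM').2.1]
          have h1 : numWords (N + 1) M ≤ 2 * altDegree (youngRep M N) := by
            rcases numWords_eq_altDegree hN hM' with h | h <;> omega
          have h2 : (numWords (N + 1) M : ℝ) ≤ 2 * altDegree (youngRep M N) := by
            exact_mod_cast h1
          have h3 : (0 : ℝ) ≤ numWords (N + 1) M := Nat.cast_nonneg _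
          nlinarith
      _ = ∑ ψ ∈ S, ∑ M ∈ (shapes (N + 1) \ B).filter (fun M => χ M = ψ), 4 * ‖χ M 1‖ ^ 2 :=
          (sum_fiberwise_of_maps_to hmaps _).symm
      _ ≤ ∑ ψ ∈ S, 8 * ‖ψ 1‖ ^ 2 := by
          refine sum_le_sum fun ψ hψ => ?_
          have hψ' : ψ ∈ Irr A := (Set.Finite.mem_toFinset _).1 (mem_filter.1 hψ).1
          rw [sum_congr rfl (g := fun _ => 4 * ‖ψ 1‖ ^ 2) fun M hM => by
            rw [(mem_filter.1 hM).2], sum_const, nsmul_eq_mul]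
          have hc := card_filter_altInner_le_two hN hψ'
            ((shapes (N + 1) \ B).filter (fun M => χ M = ψ))
            ((filter_subset _ _).trans sdiff_subset) (fun M hM => by
              obtain ⟨h1, h2⟩ := mem_filter.1 hM
              rw [← h2]
              exact (hχ M (mem_sdiff.1 h1).1).2.2.2)
          have hc' : ((((shapes (N + 1) \ B).filter (fun M => χ M = ψ)).card : ℕ) : ℝ) ≤ 2 := by
            exact_mod_cast hc
          have := mul_le_mul_of_nonneg_right hc' (show (0 : ℝ) ≤ 4 * ‖ψ 1‖ ^ 2 by positivity)
          linarith
      _ = _ := (mul_sum _ _ _).symm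
  have hfin : (b : ℝ) ^ 2 / 10000 ^ 2 ≤ 8 * ∑ χ ∈ S, ‖χ 1‖ ^ 2 := hmain.trans hle
  rw [epsilonRatio, ← hb, le_div_iff₀ (pow_pos hbR 2)]
  have e : (∑ χ ∈ S, ‖χ 1‖ ^ 2) =
    ∑ χ ∈ (Irr_finite A).toFinset with ‖χ 1‖ < (b : ℝ), ‖χ 1‖ ^ 2 := rfl
  rw [← e]
  linarith

theorem exists_irr_apply_one_eq_one (G : Type*) [Group G] : ∃ χ ∈ Irr G, χ 1 = 1 := by
  refine ⟨(Representation.trivial ℂ G ℂ).character, ⟨ℂ, inferInstance, inferInstance,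
    inferInstance, Representation.trivial ℂ G ℂ, ?_, rfl⟩, by simp [Representation.char_one]⟩
  rw [isIrreducible_iff_forall]
  exact fun I => eq_bot_or_eq_top I.toSubmodule

/-- The trivial character contributes as soon as the largest degree exceeds 1. -/
theorem epsilonRatio_pos {n : ℕ} (hn : 4 ≤ n) : 0 < epsilonRatio (alternatingGroup (Fin n)) := by
  obtain ⟨N, rfl⟩ : ∃ m, n = m + 1 := ⟨n - 1, by omega⟩
  obtain ⟨M, hM, hM3⟩ := exists_three_le_numWords hn
  obtain ⟨-, -, -, hdeg, -⟩ := exists_irr_constituent (by omega) hM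
  have hle := (isGreatest_maxIrrDegree (alternatingGroup (Fin (N + 1)))).2 hdeg
  have h2 : 2 ≤ maxIrrDegree (alternatingGroup (Fin (N + 1))) := by
    rcases numWords_eq_altDegree (by omega) hM with h | h <;> omega
  obtain ⟨χ, hχ, hχ1⟩ := exists_irr_apply_one_eq_one (alternatingGroup (Fin (N + 1)))
  have hpos : (0 : ℝ) < maxIrrDegree (alternatingGroup (Fin (N + 1))) := by
    exact_mod_cast (by omega : 0 < maxIrrDegree (alternatingGroup (Fin (N + 1))))
  refine div_pos ?_ (pow_pos hpos 2)
  refine sum_pos' (fun _ _ => sq_nonneg _)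
    ⟨χ, mem_filter.2 ⟨(Set.Finite.mem_toFinset _).2 hχ, ?_⟩, by simp [hχ1]⟩
  rw [hχ1, norm_one]
  exact_mod_cast (by omega : 1 < maxIrrDegree (alternatingGroup (Fin (N + 1))))

theorem exists_pos_le_of_forall_pos (f : ℕ → ℝ) (m n : ℕ) (h : ∀ k, m ≤ k → 0 < f k) :
    ∃ ε : ℝ, 0 < ε ∧ ∀ k, m ≤ k → k < n → ε ≤ f k := by
  induction n with
  | zero => exact ⟨1, one_pos, fun k _ hk => absurd hk (Nat.not_lt_zero k)⟩
  | succ n ih =>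
    obtain ⟨ε, hε, hle⟩ := ih
    by_cases hm : m ≤ n
    · refine ⟨min ε (f n), lt_min hε (h n hm), fun k hk hkn => ?_⟩
      rcases Nat.lt_succ_iff_lt_or_eq.1 hkn with hlt | rfl
      · exact (min_le_left _ _).trans (hle k hk hlt)
      · exact min_le_right _ _
    · exact ⟨ε, hε, fun k hk hkn => hle k hk (by omega)⟩

theorem corollary2p2 :
    ∃ ε : ℝ, 0 < ε ∧ ∀ n : ℕ, 5 ≤ n → ε ≤ epsilonRatio (alternatingGroup (Fin n)) := by
  obtain ⟨ε, hε, hle⟩ := exists_pos_le_of_forall_pos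
    (fun n => epsilonRatio (alternatingGroup (Fin n))) 5 2000000
    fun n hn => epsilonRatio_pos (by omega)
  refine ⟨min ε (1 / (8 * 10000 ^ 2)), lt_min hε (by norm_num), fun n hn => ?_⟩
  by_cases h : n < 2000000
  · exact (min_le_left _ _).trans (hle n hn h)
  · exact (min_le_right _ _).trans (le_epsilonRatio (not_lt.1 h))
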